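/- **Lemma (decoding).** Fix $k$ players, a number $n\ge 0$ of trap qubits, and a quantum circuit $C$ on $W$ wires (Clifford+$\mathsf T$ gates, possibly classically controlled on earlier measurement outcomes, and computational-basis measurements) that measures all wires except a single wire $w$, whose content is intended for player $i$. Every wire initially carries either an input qubit of one of the players or an ancilla $|0\rangle$. Let $I_{\mathcal A}\subsetneq[k]$ be the set of corrupted players, all played by one adversary (or simulator), which also receives and outputs a side-information register $R$ of qubits. *Ideal functionality without decoding* $\mathfrak I^{C}$: the players send their inputs to a trusted party, which prepares the ancillas, applies $C$, samples a uniformly random $(n+1)$-qubit Clifford $E$ (up to global phase), applies $\rho\mapsto E(\rho\otimes|0^n\rangle\langle 0^n|)E^\dagger$ to wire $w$, and sends the result to player $i$. Then all $j\in I_{\mathcal A}$ send a bit $b_j$; if all are $0$, the key $E$ and the measurement outcomes are stored in a classical state register $S$; otherwise $\bot$ is stored in $S$. *Decoding protocol* $\Pi^{\mathsf{Dec}}$: an ideal classical MPC with abort (it answers the corrupted players first, receives a bit $b'_j$ from each $j\in I_{\mathcal A}$, and answers the honest players if all these bits are $0$, sending them $\mathsf{abort}$ otherwise) holds $S$. It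 sends $E$ to player $i$; if $S=\bot$, it sends $\bot$ to everybody, on which honest players output $\mathsf{abort}$. An honest player $i$ applies $E^\dagger$ to the $n+1$ qubits, measures the $n$ traps in the computational basis, outputs the data qubit if the outcome is $0^n$, and otherwise discards it and aborts. *Ideal functionality with abort* $\mathfrak I^{\mathsf{MPQC}}_C$: the players send their inputs to a trusted party, which prepares the ancillas and applies $C$. If $i\in I_{\mathcal A}$, it sends wire $w$ to player $i$. All $j\in I_{\mathcal A}$ send a bit $b_j$. If all are $0$, the honest players receive their outputs (wire $w$, if $i\notin I_{\mathcal A}$); otherwise they receive $\mathsf{abort}$. All wires other than $w$ are discarded. An environment $\mathcal E$ prepares an arbitrary joint state of all inputs, $R$, and a private register of finitely many qubits, then receives the outputs of all players and $R$, and by an arbitrary two-outcome measurement of these and its private register produces a bit. Adversaries and simulators are quantum programs over single-qubit unitaries, CNOT, qubit resets, branching on measurement outcomes, sampling a uniformly random $m$-qubit Clifford, and applying a classically described $m$-qubit Clifford or its inverse. Their complexity is the number of qubits they hold (communication registers included) plus the program size, where both Clifford operations count $(m+1)^3$, a branching counts the number of measured qubits plus the sizes of both branches, and the other operations count $1$.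 There is a polynomial $p$ such that for all $k,n,W,C,w,i,I_{\mathcal A}$ and assignments of input wires as above, and for every adversary $\mathcal A$, there exists a simulator $\mathcal S$ of complexity at most $p(\text{complexity of }\mathcal A)$ such that for all environments $\mathcal E$, $$\Pr\big[1\leftarrow(\mathcal E\leftrightarrows(\Pi^{\mathsf{Dec}}\diamond\mathfrak I^{C})_{\mathcal A})\big]=\Pr\big[1\leftarrow(\mathcal E\leftrightarrows\mathfrak I^{\mathsf{MPQC}}_{C,\mathcal S})\big].$$ -/

import Mathlib

open scoped Matrix ComplexOrder

noncomputable section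

namespace MPQC

/-! ### Registers of qubits

A register is a type `Q` of qubit labels; its computational basis is `Q → Bool`.
Parties hold qubits of one global register; sending a qubit means handing over the right
to act on it. -/

/-- Operators on the Hilbert space of the qubits labelled by `Q`. -/
abbrev Op (Q : Type) : Type := Matrix (Q → Bool) (Q → Bool) ℂ

open Classical in
/-- The operator `V` acting on the qubits `f l`, tensored with the identity elsewhere. -/
def lift {L G : Type} (f : L → G) (V : Op L) : Op G := fun a b =>
  if ∀ g, g ∉ Set.range f → a g = b g then V (a ∘ f) (b ∘ f) else 0

open Classical in
/-- The state `ρ` on the qubits `f l`, tensored with `|0⟩⟨0|` on all other qubits. -/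
def prepare {L G : Type} (f : L → G) (ρ : Op L) : Op G := fun a b =>
  if ∀ g, g ∉ Set.range f → a g = false ∧ b g = false then ρ (a ∘ f) (b ∘ f) else 0

section Primitive
variable {L G : Type} [Fintype L] [DecidableEq L] [Fintype G] [DecidableEq G]

/-- The Kraus term `ρ ↦ K ρ K†`. -/
def sandwich (K ρ : Op G) : Op G := K * ρ * Kᴴ

/-- Unnormalised post-measurement state when measuring the qubits `f l` in the computational
basis with outcome `s`. -/
def collapse (f : L → G) (s : L → Bool) (ρ : Op G) : Op G :=
  sandwich (lift f (Matrix.single s s 1)) ρ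

/-- Erase the qubits `f l` and put them into the basis state `s`. -/
def setReg (f : L → G) (s : L → Bool) (ρ : Op G) : Op G :=
  ∑ t : L → Bool, sandwich (lift f (Matrix.single s t 1)) ρ

/-- A single-qubit operator on qubit `a`. -/
def qubitOp (a : G) (u : Matrix Bool Bool ℂ) : Op G :=
  lift (fun _ : Unit => a) (fun x y => u (x ()) (y ()))

/-- The controlled NOT with control `a` and target `b`. -/
def cnotOp (a b : G) : Op G := fun x y =>
  if x = Function.update y b (xor (y b) (y a)) then 1 else 0

end Primitive

/-! ### Paulis and Cliffords -/

/-- The single-qubit Paulis `I`, `X`, `Z`, `Y`, indexed by their `x` and `z` bits. -/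
def pauli : Bool → Bool → Matrix Bool Bool ℂ
  | false, false => 1
  | true, false => fun a b => if a = b then 0 else 1
  | false, true => fun a b => if a = b then (if a then -1 else 1) else 0
  | true, true => fun a b => if a = b then 0 else (if a then Complex.I else -Complex.I)

/-- Bits of a signed Pauli string: `none` is the sign, `some (l, false)` and `some (l, true)` are
the `x` and `z` bits at qubit `l`. -/
abbrev PauliBit (m : ℕ) : Type := Option (Fin m × Bool)

/-- The Hermitian operator `± P₁ ⊗ ⋯ ⊗ Pₘ` described by `s`. -/
def pauliOp {m : ℕ} (s : PauliBit m → Bool) : Op (Fin m) := fun a b =>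
  (if s none then -1 else 1) *
    ∏ l, pauli (s (some (l, false))) (s (some (l, true))) (a l) (b l)

/-- The generators `X_j` (for `(j, false)`) and `Z_j` (for `(j, true)`) of the Pauli group. -/
def pauliGen {m : ℕ} (g : Fin m × Bool) : Op (Fin m) :=
  pauliOp (fun o => decide (o = some g))

/-- The `m`-qubit Clifford unitaries: conjugation maps Paulis to Paulis. -/
def IsClifford {m : ℕ} (U : Op (Fin m)) : Prop :=
  U ∈ Matrix.unitaryGroup (Fin m → Bool) ℂ ∧
    ∀ s : PauliBit m → Bool, ∃ t : PauliBit m → Bool, U * pauliOp s * Uᴴ = pauliOp t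

/-- Bit positions in the classical description (tableau) of an `m`-qubit Clifford: the bits of
the images of the generators. -/
abbrev KeyBit (m : ℕ) : Type := (Fin m × Bool) × PauliBit m

/-- The tableau `t` describes the Clifford unitary `U`. It determines `U` up to a global phase. -/
def Describes {m : ℕ} (t : KeyBit m → Bool) (U : Op (Fin m)) : Prop :=
  IsClifford U ∧ ∀ g, U * pauliGen g * Uᴴ = pauliOp (fun o => t (g, o))

/-- The (finite) `m`-qubit Clifford group modulo global phases; an element is given by its
tableau. -/
def CliffordKey (m : ℕ) : Type := {t : KeyBit m → Bool // ∃ U, Describes t U}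

instance (m : ℕ) : Fintype (CliffordKey m) :=
  @Subtype.fintype _ _ (Classical.decPred _) inferInstance

/-- The description of a Clifford as a bit string. -/
def CliffordKey.bits {m : ℕ} (E : CliffordKey m) : KeyBit m → Bool := E.1

/-- A unitary representing the Clifford (all choices differ by a global phase). -/
def CliffordKey.unitary {m : ℕ} (E : CliffordKey m) : Op (Fin m) := Classical.choose E.2

open Classical in
/-- The Clifford unitary with description `t`; the identity if `t` is not a description. -/
def describedUnitary {m : ℕ} (t : KeyBit m → Bool) : Op (Fin m) :=
  if h : ∃ U, Describes t U then Classical.choose h else 1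

/-! ### Quantum programs and their cost -/

/-- Programs of a quantum machine holding the qubits `L`: arbitrary single-qubit unitaries, CNOT,
resets, branching on a measurement outcome (first branch if all outcomes are `0`), sampling of a
uniformly random Clifford (as a description in a register), and application of a classically
described Clifford or of its inverse. -/
inductive Prog (L : Type) : Type
  | skip : Prog L
  | seq (p q : Prog L) : Prog L
  | gate (a : L) (u : Matrix.unitaryGroup Bool ℂ) : Prog L
  | cnot (a b : L) (h : a ≠ b) : Prog L
  | reset (a : L) : Prog L
  | branch {c : ℕ} (reg : Fin c → L) (p q : Prog L) : Prog L
  | sample {m : ℕ} (key : KeyBit m ↪ L) : Prog L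
  | apply {m : ℕ} (inverse : Bool) (reg : KeyBit m ⊕ Fin m ↪ L) : Prog L

/-- Number of elementary operations; handling an `m`-qubit Clifford is charged `(m + 1) ^ 3`. -/
def Prog.cost {L : Type} : Prog L → ℕ
  | .skip => 0
  | .seq p q => p.cost + q.cost
  | .gate _ _ => 1
  | .cnot _ _ _ => 1
  | .reset _ => 1
  | @Prog.branch _ c _ p q => c + p.cost + q.cost
  | @Prog.sample _ m _ => (m + 1) ^ 3
  | @Prog.apply _ m _ _ => (m + 1) ^ 3

/-- Run a program on the qubits `f l` of a global register. -/
def Prog.run {L G : Type} [Fintype G] [DecidableEq G] (f : L → G) : Prog L → Op G → Op G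
  | .skip, ρ => ρ
  | .seq p q, ρ => q.run f (p.run f ρ)
  | .gate a u, ρ => sandwich (qubitOp (f a) u) ρ
  | .cnot a b _, ρ => sandwich (cnotOp (f a) (f b)) ρ
  | .reset a, ρ => setReg (fun _ : Unit => f a) (fun _ => false) ρ
  | @Prog.branch _ c reg p q, ρ => ∑ s : Fin c → Bool,
      if s = fun _ => false then p.run f (collapse (f ∘ reg) s ρ)
      else q.run f (collapse (f ∘ reg) s ρ)
  | @Prog.sample _ m key, ρ =>
      (Fintype.card (CliffordKey m) : ℂ)⁻¹ •
        ∑ E : CliffordKey m, setReg (fun x => f (key x)) E.bits ρ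
  | @Prog.apply _ m inverse reg, ρ => ∑ t : KeyBit m → Bool,
      sandwich (lift (fun x => f (reg (Sum.inr x)))
          (if inverse then (describedUnitary t)ᴴ else describedUnitary t))
        (collapse (fun x => f (reg (Sum.inl x))) t ρ)

/-! ### Circuits -/

/-- Elementary gates on `W` wires. -/
inductive ElemGate (W : ℕ) : Type
  | hadamard (v : Fin W) : ElemGate W
  | phase (v : Fin W) : ElemGate W
  | tgate (v : Fin W) : ElemGate W
  | cnot (u v : Fin W) (h : u ≠ v) : ElemGate W

/-- The wires a gate acts on. -/
def ElemGate.wires {W : ℕ} : ElemGate W → Finset (Fin W)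
  | .hadamard v => {v}
  | .phase v => {v}
  | .tgate v => {v}
  | .cnot u v _ => {u, v}

/-- The unitary of a gate. -/
def ElemGate.op {W : ℕ} : ElemGate W → Op (Fin W)
  | .hadamard v => qubitOp v (fun a b => (if a && b then -1 else 1) / (Real.sqrt 2 : ℂ))
  | .phase v => qubitOp v (Matrix.diagonal fun a => if a then Complex.I else 1)
  | .tgate v => qubitOp v
      (Matrix.diagonal fun a => if a then Complex.exp (Complex.I * (Real.pi / 4 : ℝ)) else 1)
  | .cnot u v _ => cnotOp u v

/-- A step of a circuit: a gate controlled on a Boolean function `cond` of the outcomes of earlier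
measurements, or a computational-basis measurement after which the wire is classical. -/
inductive Step (W : ℕ) : Type
  | gate (cond : (Fin W → Bool) → Bool) (g : ElemGate W) : Step W
  | meas (v : Fin W) : Step W

/-- A step may occur when exactly the wires in `D` have been measured: gates and measurements act
on unmeasured wires, and controls only read measured wires. -/
def Step.Ok {W : ℕ} (D : Finset (Fin W)) : Step W → Prop
  | .gate cond g => Disjoint g.wires D ∧
      ∀ x y : Fin W → Bool, (∀ v ∈ D, x v = y v) → cond x = cond y
  | .meas v => v ∉ D

/-- The measured wires after a step. -/
def Step.next {W : ℕ} (D : Finset (Fin W)) : Step W → Finset (Fin W)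
  | .gate _ _ => D
  | .meas v => insert v D

/-- Started with the measured wires `D`, the steps form a circuit that leaves exactly the wire `w`
unmeasured. -/
def LeavesOnly {W : ℕ} (w : Fin W) : Finset (Fin W) → List (Step W) → Prop
  | D, [] => ∀ v, v ∈ D ↔ v ≠ w
  | D, s :: C => s.Ok D ∧ LeavesOnly w (s.next D) C

/-- Effect of a step on the wires `f v`; a measured wire keeps its outcome as a classical bit. -/
def Step.run {W : ℕ} {G : Type} [Fintype G] [DecidableEq G] (f : Fin W → G) :
    Step W → Op G → Op G
  | .gate cond g, ρ =>
      sandwich (lift f (fun x y => if cond y then g.op x y else (1 : Op (Fin W)) x y)) ρ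
  | .meas v, ρ => ∑ s : Unit → Bool, collapse (fun _ => f v) s ρ

/-- Run a circuit on the wires `f v`. -/
def runCircuit {W : ℕ} {G : Type} [Fintype G] [DecidableEq G] (f : Fin W → G)
    (C : List (Step W)) (ρ : Op G) : Op G :=
  C.foldl (fun σ s => s.run f σ) ρ

/-! ### The computation task -/

/-- A task: `k` players, a circuit `C` on `W` wires, the owner of every input wire (`none` for an
ancilla wire), the output wire `w` and the player `i` receiving it (all other wires are discarded),
the number `n` of trap qubits, and the set of corrupted players. -/
structure Task where
  n : ℕ
  k : ℕ
  W : ℕ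
  C : List (Step W)
  owner : Fin W → Option (Fin k)
  w : Fin W
  i : Fin k
  corrupt : Finset (Fin k)

variable (P : Task)

/-- The corrupted players. -/
abbrev Task.Bad : Type := {j : Fin P.k // j ∈ P.corrupt}

/-- The honest players. -/
abbrev Task.Good : Type := {j : Fin P.k // j ∉ P.corrupt}

/-- The wires that carry an input of some player. -/
abbrev Task.InputWire : Type := {v : Fin P.W // (P.owner v).isSome = true}

/-- An environment, for `r` qubits of side information: it keeps `e` private qubits, prepares a
joint state of these, of all players' inputs and of the adversary's side information, and finally
measures (with effect `M` for the output bit `1`) its private qubits, the output wire of player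
`i`, the side information and the abort flags output by the honest players. -/
structure Environment (r : ℕ) where
  e : ℕ
  ρ : Op (P.InputWire ⊕ Fin r ⊕ Fin e)
  ρ_pos : ρ.PosSemidef
  ρ_trace : ρ.trace = 1
  M : Op (Unit ⊕ P.Good ⊕ Fin r ⊕ Fin e)
  M_pos : M.PosSemidef
  M_le : (1 - M).PosSemidef

/-! ### Real world: ideal functionality without decoding, then the decoding protocol -/

/-- The qubits in the real world, except the environment's private ones. -/
inductive RealReg (r q : ℕ) : Type
  | wire (v : Fin P.W) : RealReg r q
  | trap (t : Fin P.n) : RealReg r q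
  | side (x : Fin r) : RealReg r q
  | work (x : Fin q) : RealReg r q
  | bit (j : P.Bad) : RealReg r q
  | mpcBit (j : P.Bad) : RealReg r q
  | key (x : KeyBit (P.n + 1)) : RealReg r q
  | status : RealReg r q
  | flag (j : P.Good) : RealReg r q
  deriving DecidableEq, Fintype

variable {P}

/-- Held by the adversary before the inputs are sent: inputs of corrupted players, side information
and workspace. -/
def RealReg.Held₀ {r q : ℕ} : RealReg P r q → Prop
  | .wire v => ∃ j ∈ P.corrupt, P.owner v = some j
  | .side _ | .work _ => True
  | _ => False

/-- Held by the adversary after encoded outputs have been distributed: the encoded output if player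
`i` is corrupted, and the bits to be sent to the functionality. -/
def RealReg.Held₁ {r q : ℕ} : RealReg P r q → Prop
  | .wire v => v = P.w ∧ P.i ∈ P.corrupt
  | .trap _ => P.i ∈ P.corrupt
  | .side _ | .work _ | .bit _ => True
  | _ => False

/-- Held by the adversary after the classical MPC has answered the corrupted players: also the
answer (a status bit, set if the answer is `⊥`, and the key register if player `i` is corrupted),
and the abort bits to be sent to the MPC. -/
def RealReg.Held₂ {r q : ℕ} : RealReg P r q → Prop
  | .wire v => v = P.w ∧ P.i ∈ P.corrupt
  | .trap _ | .key _ => P.i ∈ P.corrupt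
  | .side _ | .work _ | .mpcBit _ | .status => True
  | _ => False

variable (P) in
/-- An adversary playing all corrupted players in the real world. -/
structure Adversary (r : ℕ) where
  work : ℕ
  onInput : Prog {x : RealReg P r work // x.Held₀}
  onEncoded : Prog {x : RealReg P r work // x.Held₁}
  onKey : Prog {x : RealReg P r work // x.Held₂}

/-- Number of qubits handled plus number of elementary operations. -/
def Adversary.complexity {r : ℕ} (A : Adversary P r) : ℕ :=
  Nat.card {x : RealReg P r A.work // x.Held₀ ∨ x.Held₁ ∨ x.Held₂}
    + (A.onInput.cost + A.onEncoded.cost + A.onKey.cost)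

variable (P) in
/-- Content of the state register after the functionality without decoding: the key and the
measurement outcomes, or `⊥`. -/
abbrev StateReg : Type :=
  Option (CliffordKey (P.n + 1) × ({v : Fin P.W // v ≠ P.w} → Bool))

namespace Adversary

variable {r : ℕ} (A : Adversary P r) (e : ℕ)

/-- All qubits in the real world. -/
abbrev Global : Type := RealReg P r A.work ⊕ Fin e

/-- The encoded output: data qubit on the output wire, followed by the traps. -/
def code (x : Fin (P.n + 1)) : A.Global e :=
  Sum.inl (Fin.cases (RealReg.wire P.w) (fun t => RealReg.trap t) x)

/-- The joint state after inputs, application of the circuit, encoding with key `E`, and the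
adversary's action on its encoded output. -/
def afterEncoding (E : CliffordKey (P.n + 1)) (ρ : Op (A.Global e)) : Op (A.Global e) :=
  A.onEncoded.run (fun x => Sum.inl x.1)
    (sandwich (lift (A.code e) E.unitary)
      (runCircuit (fun v => Sum.inl (RealReg.wire v)) P.C
        (A.onInput.run (fun x => Sum.inl x.1) ρ)))

/-- The ideal functionality without decoding, with the adversary on the corrupted interfaces. The
result is a classical-quantum state: for every content of the state register, the corresponding
unnormalised state of all qubits. -/
def idealWithoutDecoding (ρ : Op (A.Global e)) : StateReg P → Op (A.Global e)
  | some (E, o) => (Fintype.card (CliffordKey (P.n + 1)) : ℂ)⁻¹ •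
      collapse (fun v : {v : Fin P.W // v ≠ P.w} => Sum.inl (RealReg.wire v.1)) o
        (collapse (fun j : P.Bad => Sum.inl (RealReg.bit j)) (fun _ => false)
          (A.afterEncoding e E ρ))
  | none => (Fintype.card (CliffordKey (P.n + 1)) : ℂ)⁻¹ • ∑ E : CliffordKey (P.n + 1),
      ∑ b ∈ (Finset.univ : Finset (P.Bad → Bool)).erase (fun _ => false),
        collapse (fun j : P.Bad => Sum.inl (RealReg.bit j)) b (A.afterEncoding e E ρ)

/-- The honest players output `abort`: their flags are set, and an honest player `i` gives no
output qubit (represented by `|0⟩`). -/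
def abort (ρ : Op (A.Global e)) : Op (A.Global e) :=
  let σ := setReg (fun j : P.Good => Sum.inl (RealReg.flag j)) (fun _ => true) ρ
  if P.i ∈ P.corrupt then σ
  else setReg (fun _ : Unit => Sum.inl (RealReg.wire P.w)) (fun _ => false) σ

/-- Player `i`, if honest, undoes the Clifford `E`, measures the traps, and aborts if they are not
all zero. -/
def decode (E : CliffordKey (P.n + 1)) (ρ : Op (A.Global e)) : Op (A.Global e) :=
  if P.i ∈ P.corrupt then ρ
  else ∑ t : Fin P.n → Bool,
    let σ := collapse (fun x => Sum.inl (RealReg.trap x)) t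
      (sandwich (lift (A.code e) (E.unitary)ᴴ) ρ)
    if t = fun _ => false then σ else A.abort e σ

/-- The decoding protocol, started with content `s` of the state register of the classical MPC. The
MPC answers the corrupted players first (the key to player `i`, or `⊥` to everybody if `s = ⊥`),
receives their abort bits, and then answers the honest players or sends them `abort`. -/
def decodingProtocol (s : StateReg P) (ρ : Op (A.Global e)) : Op (A.Global e) :=
  let answered : Op (A.Global e) := match s with
    | none => setReg (fun _ : Unit => Sum.inl RealReg.status) (fun _ => true) ρ
    | some (E, _) =>
        if P.i ∈ P.corrupt then
          setReg (fun x : KeyBit (P.n + 1) => Sum.inl (RealReg.key x)) E.bits ρ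
        else ρ
  let σ := A.onKey.run (fun x => Sum.inl x.1) answered
  ∑ b : P.Bad → Bool,
    let τ := collapse (fun j : P.Bad => Sum.inl (RealReg.mpcBit j)) b σ
    match s with
    | none => A.abort e τ
    | some (E, _) => if b = fun _ => false then A.decode e E τ else A.abort e τ

end Adversary

/-- Probability that the environment outputs `1` when interacting with the decoding protocol
composed with the ideal functionality without decoding, under attack by `A`. -/
def realProb {r : ℕ} (A : Adversary P r) (Z : Environment P r) : ℝ :=
  let inputs : P.InputWire ⊕ Fin r ⊕ Fin Z.e → A.Global Z.e
    | .inl v => .inl (.wire v.1)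
    | .inr (.inl x) => .inl (.side x)
    | .inr (.inr x) => .inr x
  let outputs : Unit ⊕ P.Good ⊕ Fin r ⊕ Fin Z.e → A.Global Z.e
    | .inl _ => .inl (.wire P.w)
    | .inr (.inl j) => .inl (.flag j)
    | .inr (.inr (.inl x)) => .inl (.side x)
    | .inr (.inr (.inr x)) => .inr x
  let σ := A.idealWithoutDecoding Z.e (prepare inputs Z.ρ)
  (Matrix.trace (lift outputs Z.M * ∑ s : StateReg P, A.decodingProtocol Z.e s (σ s))).re

/-! ### Ideal world: multi-party quantum computation with abort -/

variable (P) in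
/-- The qubits in the ideal world, except the environment's private ones. -/
inductive IdealReg (r q : ℕ) : Type
  | wire (v : Fin P.W) : IdealReg r q
  | side (x : Fin r) : IdealReg r q
  | work (x : Fin q) : IdealReg r q
  | bit (j : P.Bad) : IdealReg r q
  | flag (j : P.Good) : IdealReg r q
  deriving DecidableEq, Fintype

/-- Held by the simulator before the inputs are sent. -/
def IdealReg.Held₀ {r q : ℕ} : IdealReg P r q → Prop
  | .wire v => ∃ j ∈ P.corrupt, P.owner v = some j
  | .side _ | .work _ => True
  | _ => False

/-- Held by the simulator after the corrupted players' outputs have been sent. -/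
def IdealReg.Held₁ {r q : ℕ} : IdealReg P r q → Prop
  | .wire v => v = P.w ∧ P.i ∈ P.corrupt
  | .side _ | .work _ | .bit _ => True
  | _ => False

variable (P) in
/-- A simulator playing all corrupted players in the ideal world. -/
structure Simulator (r : ℕ) where
  work : ℕ
  onInput : Prog {x : IdealReg P r work // x.Held₀}
  onOutput : Prog {x : IdealReg P r work // x.Held₁}

/-- Number of qubits handled plus number of elementary operations. -/
def Simulator.complexity {r : ℕ} (S : Simulator P r) : ℕ :=
  Nat.card {x : IdealReg P r S.work // x.Held₀ ∨ x.Held₁} + (S.onInput.cost + S.onOutput.cost)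

namespace Simulator

variable {r : ℕ} (S : Simulator P r) (e : ℕ)

/-- All qubits in the ideal world. -/
abbrev Global : Type := IdealReg P r S.work ⊕ Fin e

/-- The honest players receive `abort` instead of their outputs. -/
def abort (ρ : Op (S.Global e)) : Op (S.Global e) :=
  let σ := setReg (fun j : P.Good => Sum.inl (IdealReg.flag j)) (fun _ => true) ρ
  if P.i ∈ P.corrupt then σ
  else setReg (fun _ : Unit => Sum.inl (IdealReg.wire P.w)) (fun _ => false) σ

/-- The ideal functionality for computation with abort, with the simulator on the corrupted
interfaces: inputs, circuit, outputs to corrupted players, abort bits, and outputs to the honest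
players or `abort`. -/
def idealMPQC (ρ : Op (S.Global e)) : Op (S.Global e) :=
  let σ := S.onOutput.run (fun x => Sum.inl x.1)
    (runCircuit (fun v => Sum.inl (IdealReg.wire v)) P.C
      (S.onInput.run (fun x => Sum.inl x.1) ρ))
  ∑ b : P.Bad → Bool,
    let τ := collapse (fun j : P.Bad => Sum.inl (IdealReg.bit j)) b σ
    if b = fun _ => false then τ else S.abort e τ

end Simulator

/-- Probability that the environment outputs `1` when interacting with the ideal functionality for
computation with abort, with simulator `S`. -/
def idealProb {r : ℕ} (S : Simulator P r) (Z : Environment P r) : ℝ :=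
  let inputs : P.InputWire ⊕ Fin r ⊕ Fin Z.e → S.Global Z.e
    | .inl v => .inl (.wire v.1)
    | .inr (.inl x) => .inl (.side x)
    | .inr (.inr x) => .inr x
  let outputs : Unit ⊕ P.Good ⊕ Fin r ⊕ Fin Z.e → S.Global Z.e
    | .inl _ => .inl (.wire P.w)
    | .inr (.inl j) => .inl (.flag j)
    | .inr (.inr (.inl x)) => .inl (.side x)
    | .inr (.inr (.inr x)) => .inr x
  (Matrix.trace (lift outputs Z.M * S.idealMPQC Z.e (prepare inputs Z.ρ))).re

end MPQC

end

open scoped Matrix ComplexOrder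

noncomputable section
set_option linter.unusedSectionVars false

namespace MPQC

/-! ### Operators and superoperators supported on a set of qubits -/

section Support
variable {L G : Type}

/-! The authentication code is never attacked here, so the equality is exact and no randomization
property of the Clifford group is needed. If player `i` is honest, the code passes from the trusted
party to player `i` untouched by the adversary. If player `i` is corrupted, no honest player
decodes, and the adversary's view of code and key is easy to reproduce.

The simulator runs the adversary inside. If `i` is corrupted, it encodes the clear output under a
key it samples itself, with its own traps. After the adversary's second program it measures the bits
meant for the functionality without decoding. If all are zero, it runs the last program with the key
in place, and turns a nonzero bit sent to the classical MPC into a nonzero bit sent to the ideal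
functionality. Otherwise the state register would contain `⊥`: it erases the key, announces `⊥`,
runs the last program, and the nonzero bits already make the functionality abort.

Corrupted `i` (`trace_real_of_mem`): the simulator's key register is filled before the real one
would be, but no operation in between touches it, so writing it commutes with them. On rejection,
erasing it restores the zeros that the real register still contains. Both experiments are then the
same average over keys, term by term.

Honest `i` (`trace_real_of_notMem`): for each fixed key the encoding commutes with everything the
adversary does. On acceptance it meets its inverse and the traps read zero; on abort the output wire
is erased and the traps are discarded, which hides the unitary (`trace_mul_setReg_sandwich`). Every
key thus contributes the same value, the one without encoding.

Two tools carry the argument. Superoperators with disjoint supports commute (`Local.commute`), where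
the support of a program is the set of qubits its owner holds (`Local.prog_run`). The two worlds
have different registers; they are compared by adjoining the missing qubits in state zero, an
isometry that intertwines all operations (`prepare_idealMPQC`). The complexity bound holds because
every simulator qubit stands for a qubit the adversary holds at some stage, and because the code and
the key are among these whenever the simulator must encode. -/

/-- The operator `K` is an operator on the qubits in `s` tensored with the identity elsewhere. -/
def ActsOn (s : Set G) (K : Op G) : Prop :=
  (∀ a b, K a b ≠ 0 → Set.EqOn a b sᶜ) ∧
    ∀ a b a' b', Set.EqOn a b sᶜ → Set.EqOn a' b' sᶜ → Set.EqOn a a' s → Set.EqOn b b' s →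
      K a b = K a' b'

theorem ActsOn.mono {s t : Set G} {K : Op G} (h : ActsOn s K) (hst : s ⊆ t) : ActsOn t K := by
  refine ⟨fun a b hab => (h.1 a b hab).mono (Set.compl_subset_compl.2 hst), ?_⟩
  intro a b a' b' h1 h2 h3 h4
  -- Agreement off `s` splits into agreement off `t`, which both pairs have, and agreement on `t \
  -- s`, where the pairs coincide. If it fails, it fails for both pairs and both entries vanish.
  have key : Set.EqOn a b sᶜ ↔ Set.EqOn a' b' sᶜ := by
    constructor <;> intro h5 g hg <;> by_cases hgt : g ∈ t
    · rw [← h3 hgt, ← h4 hgt, h5 hg]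
    · exact h2 hgt
    · rw [h3 hgt, h4 hgt, h5 hg]
    · exact h1 hgt
  by_cases h5 : Set.EqOn a b sᶜ
  · exact h.2 a b a' b' h5 (key.1 h5) (h3.mono hst) (h4.mono hst)
  · have e1 : K a b = 0 := by
      by_contra hne
      exact h5 (h.1 _ _ hne)
    have e2 : K a' b' = 0 := by
      by_contra hne
      exact h5 (key.2 (h.1 _ _ hne))
    rw [e1, e2]

theorem actsOn_lift (f : L → G) (V : Op L) : ActsOn (Set.range f) (lift f V) := by
  refine ⟨fun a b hab => ?_, fun a b a' b' h1 h2 h3 h4 => ?_⟩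
  · by_contra hne
    exact hab (if_neg fun h => hne fun g hg => h g hg)
  · have e1 : a ∘ f = a' ∘ f := funext fun l => h3 ⟨l, rfl⟩
    have e2 : b ∘ f = b' ∘ f := funext fun l => h4 ⟨l, rfl⟩
    have g1 : ∀ g, g ∉ Set.range f → a g = b g := fun g hg => h1 hg
    have g2 : ∀ g, g ∉ Set.range f → a' g = b' g := fun g hg => h2 hg
    simp only [lift, if_pos g1, if_pos g2, e1, e2]

variable [Fintype G] [DecidableEq G]

theorem actsOn_cnotOp (x y : G) : ActsOn {x, y} (cnotOp x y) := by
  refine ⟨fun a b hab g hg => ?_, fun a b a' b' h1 h2 h3 h4 => ?_⟩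
  · have h : a = Function.update b y (xor (b y) (b x)) := by
      by_contra hne
      exact hab (if_neg hne)
    have hgy : g ≠ y := fun e => hg (by simp [e])
    rw [h, Function.update_of_ne hgy]
  · have hx : x ∈ ({x, y} : Set G) := by simp
    have hy : y ∈ ({x, y} : Set G) := by simp
    have : a = Function.update b y (xor (b y) (b x)) ↔
        a' = Function.update b' y (xor (b' y) (b' x)) := by
      simp only [funext_iff]
      refine forall_congr' fun g => ?_
      by_cases hgy : g = y
      · subst hgy
        simp [h3 hy, h4 hy, h4 hx]
      · rw [Function.update_of_ne hgy, Function.update_of_ne hgy]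
        by_cases hg : g ∈ ({x, y} : Set G)
        · rw [h3 hg, h4 hg]
        · simp [h1 hg, h2 hg]
    simp only [cnotOp, this]

open Classical in
-- Only one intermediate basis state contributes: it must agree with `a` off `s` because of `K`, and
-- with `b` on `s` because `K'` leaves `s` alone.
theorem ActsOn.mul_apply {s t : Set G} {K K' : Op G} (hst : Disjoint s t) (hK : ActsOn s K)
    (hK' : ActsOn t K') (a b : G → Bool) :
    (K * K') a b = K a (s.piecewise b a) * K' (s.piecewise b a) b := by
  rw [Matrix.mul_apply]
  refine Finset.sum_eq_single _ (fun c _ hc => ?_) (fun h => absurd (Finset.mem_univ _) h)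
  by_contra hne
  obtain ⟨h1, h2⟩ := mul_ne_zero_iff.1 hne
  refine hc (funext fun g => ?_)
  by_cases hg : g ∈ s
  · rw [Set.piecewise_eq_of_mem _ _ _ hg]
    exact hK'.1 _ _ h2 (Set.disjoint_left.1 hst hg)
  · rw [Set.piecewise_eq_of_notMem _ _ _ hg]
    exact (hK.1 _ _ h1 hg).symm

/-- Each product has a single surviving intermediate state. If `a` and `b` agree off `s ∪ t` the
factors coincide, since an entry depends only on the values in the support; otherwise both products
vanish. -/
theorem ActsOn.commute {s t : Set G} {K K' : Op G} (hst : Disjoint s t) (hK : ActsOn s K)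
    (hK' : ActsOn t K') : K * K' = K' * K := by
  classical
  ext a b
  rw [ActsOn.mul_apply hst hK hK', ActsOn.mul_apply hst.symm hK' hK]
  have hs := fun g (h : g ∈ s) => Set.disjoint_left.1 hst h
  have ht := fun g (h : g ∈ t) => Set.disjoint_right.1 hst h
  by_cases hab : Set.EqOn a b (s ∪ t)ᶜ
  · have e1 : K a (s.piecewise b a) = K (t.piecewise b a) b := by
      refine hK.2 _ _ _ _ (fun g hg => ?_) (fun g hg => ?_) (fun g hg => ?_) (fun g hg => ?_)
      · simp [Set.piecewise, show g ∉ s from hg]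
      · by_cases hgt : g ∈ t
        · simp [Set.piecewise, hgt]
        · simpa [Set.piecewise, hgt] using hab (show g ∈ (s ∪ t)ᶜ from fun h => h.elim hg hgt)
      · simp [Set.piecewise, hs g hg]
      · simp [Set.piecewise, hg]
    have e2 : K' (s.piecewise b a) b = K' a (t.piecewise b a) := by
      refine hK'.2 _ _ _ _ (fun g hg => ?_) (fun g hg => ?_) (fun g hg => ?_) (fun g hg => ?_)
      · by_cases hgt : g ∈ s
        · simp [Set.piecewise, hgt]
        · simpa [Set.piecewise, hgt] using hab (show g ∈ (s ∪ t)ᶜ from fun h => h.elim hgt hg)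
      · simp [Set.piecewise, show g ∉ t from hg]
      · simp [Set.piecewise, ht g hg]
      · simp [Set.piecewise, hg]
    rw [e1, e2, mul_comm]
  · obtain ⟨g, hg, hne⟩ : ∃ g, g ∉ s ∪ t ∧ a g ≠ b g := by
      by_contra! hcon
      exact hab fun g hg => hcon g hg
    have hgs : g ∉ s := fun h => hg (Or.inl h)
    have hgt : g ∉ t := fun h => hg (Or.inr h)
    have e1 : K' (s.piecewise b a) b = 0 := by
      by_contra h0
      have := hK'.1 _ _ h0 hgt
      rw [Set.piecewise_eq_of_notMem _ _ _ hgs] at this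
      exact hne this
    have e2 : K (t.piecewise b a) b = 0 := by
      by_contra h0
      have := hK.1 _ _ h0 hgs
      rw [Set.piecewise_eq_of_notMem _ _ _ hgt] at this
      exact hne this
    rw [e1, e2, mul_zero, mul_zero]

theorem actsOn_one (s : Set G) : ActsOn s (1 : Op G) := by
  refine ActsOn.mono (s := ∅) ⟨fun a b hab => ?_, fun a b a' b' h1 h2 _ _ => ?_⟩
    (Set.empty_subset s)
  · by_cases h : a = b
    · simp [h]
    · exact absurd (Matrix.one_apply_ne h) hab
  · simp only [Set.compl_empty, Set.eqOn_univ] at h1 h2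
    rw [h1, h2, Matrix.one_apply_eq, Matrix.one_apply_eq]

/-! ### Kraus terms and the superoperators they generate -/

theorem sandwich_sandwich (K K' ρ : Op G) :
    sandwich K (sandwich K' ρ) = sandwich (K * K') ρ := by
  simp only [sandwich, Matrix.conjTranspose_mul, Matrix.mul_assoc]

theorem sandwich_one (ρ : Op G) : sandwich 1 ρ = ρ := by
  simp [sandwich]

theorem zero_sandwich (ρ : Op G) : sandwich 0 ρ = 0 := by
  simp [sandwich]

theorem isLinearMap_sandwich (K : Op G) : IsLinearMap ℂ (sandwich K) :=
  ⟨fun ρ σ => by simp [sandwich, Matrix.mul_add, Matrix.add_mul],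
    fun c ρ => by simp [sandwich]⟩

/-- Superoperators generated by Kraus terms supported on the qubits in `s`. -/
inductive Local (s : Set G) : (Op G → Op G) → Prop
  | sandwich {K : Op G} (h : ActsOn s K) : Local s (sandwich K)
  | comp {Φ Ψ : Op G → Op G} (hΦ : Local s Φ) (hΨ : Local s Ψ) : Local s fun ρ => Φ (Ψ ρ)
  | smul (c : ℂ) {Φ : Op G → Op G} (hΦ : Local s Φ) : Local s fun ρ => c • Φ ρ
  | sum {ι : Type} (t : Finset ι) {Φ : ι → Op G → Op G} (hΦ : ∀ i, Local s (Φ i)) :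
      Local s fun ρ => ∑ i ∈ t, Φ i ρ

theorem Local.id (s : Set G) : Local s fun ρ : Op G => ρ := by
  have h := Local.sandwich (actsOn_one s)
  rwa [show MPQC.sandwich (1 : Op G) = fun ρ => ρ from funext sandwich_one] at h

theorem Local.mono {s t : Set G} (hst : s ⊆ t) {Φ : Op G → Op G} (h : Local s Φ) :
    Local t Φ := by
  induction h with
  | sandwich h => exact .sandwich (h.mono hst)
  | comp _ _ h1 h2 => exact .comp h1 h2
  | smul c _ h => exact .smul c h
  | sum u _ h => exact .sum u h

theorem Local.ite {s : Set G} (p : Prop) [Decidable p] {Φ Ψ : Op G → Op G} (hΦ : Local s Φ)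
    (hΨ : Local s Ψ) : Local s fun ρ => if p then Φ ρ else Ψ ρ := by
  by_cases h : p
  · simpa [h] using hΦ
  · simpa [h] using hΨ

theorem Local.isLinearMap {s : Set G} {Φ : Op G → Op G} (h : Local s Φ) : IsLinearMap ℂ Φ := by
  induction h with
  | sandwich h => exact isLinearMap_sandwich _
  | comp _ _ h1 h2 =>
      exact ⟨fun x y => by rw [h2.map_add, h1.map_add], fun c x => by rw [h2.map_smul, h1.map_smul]⟩
  | smul c _ h =>
      exact ⟨fun x y => by rw [h.map_add, smul_add],
        fun d x => by rw [h.map_smul, smul_comm]⟩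
  | sum u _ h =>
      refine ⟨fun x y => ?_, fun c x => ?_⟩
      · rw [← Finset.sum_add_distrib]
        exact Finset.sum_congr rfl fun i _ => (h i).map_add x y
      · rw [Finset.smul_sum]
        exact Finset.sum_congr rfl fun i _ => (h i).map_smul c x

theorem Local.map_sum {s : Set G} {Φ : Op G → Op G} (h : Local s Φ) {ι : Type} (t : Finset ι)
    (ρ : ι → Op G) : Φ (∑ i ∈ t, ρ i) = ∑ i ∈ t, Φ (ρ i) :=
  _root_.map_sum (IsLinearMap.mk' Φ h.isLinearMap) ρ t

theorem Local.map_smul {s : Set G} {Φ : Op G → Op G} (h : Local s Φ) (c : ℂ) (ρ : Op G) :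
    Φ (c • ρ) = c • Φ ρ :=
  h.isLinearMap.map_smul c ρ

theorem Local.map_zero {s : Set G} {Φ : Op G → Op G} (h : Local s Φ) : Φ 0 = 0 :=
  h.isLinearMap.map_zero

/-- Both superoperators are built from Kraus terms by linear operations and composition, so a double
induction reduces the claim to `ActsOn.commute`. -/
theorem Local.commute {s t : Set G} (hst : Disjoint s t) {Φ Ψ : Op G → Op G} (hΦ : Local s Φ)
    (hΨ : Local t Ψ) (ρ : Op G) : Φ (Ψ ρ) = Ψ (Φ ρ) := by
  induction hΦ generalizing ρ with
  | sandwich hK =>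
      induction hΨ generalizing ρ with
      | sandwich hK' =>
          rw [sandwich_sandwich, sandwich_sandwich, ActsOn.commute hst hK hK']
      | comp _ _ h1 h2 => rw [h1, h2]
      | smul c _ h => rw [(isLinearMap_sandwich _).map_smul, h]
      | sum u _ h =>
          rw [(Local.sandwich hK).map_sum]
          exact Finset.sum_congr rfl fun i _ => h i ρ
  | comp _ _ h1 h2 => simp only [h2, h1]
  | smul c _ h => simp only [hΨ.map_smul, h]
  | sum u _ h =>
      simp only [hΨ.map_sum]
      exact Finset.sum_congr rfl fun i _ => h i ρ

theorem local_sandwich_lift (f : L → G) (V : Op L) :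
    Local (Set.range f) (sandwich (lift f V)) :=
  .sandwich (actsOn_lift f V)

variable [Fintype L] [DecidableEq L]

theorem local_collapse (f : L → G) (s : L → Bool) : Local (Set.range f) (collapse f s) :=
  local_sandwich_lift f _

theorem local_setReg (f : L → G) (s : L → Bool) : Local (Set.range f) (setReg f s) :=
  .sum _ fun _ => local_sandwich_lift f _

/-- The label type of a program says which qubits its owner holds; here that typing becomes a bound
on the support, so that programs commute with whatever happens elsewhere. -/
theorem Local.prog_run {N : Type} (f : N → G) (p : Prog N) : Local (Set.range f) (p.run f) := by
  induction p with
  | skip => exact Local.id _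
  | seq p q hp hq => exact Local.comp (Φ := q.run f) (Ψ := p.run f) hq hp
  | gate a u =>
      refine (local_sandwich_lift (fun _ : Unit => f a) _).mono ?_
      rintro _ ⟨x, rfl⟩
      exact ⟨a, rfl⟩
  | cnot a b h =>
      refine (Local.sandwich (actsOn_cnotOp (f a) (f b))).mono ?_
      rintro _ (rfl | rfl)
      exacts [⟨a, rfl⟩, ⟨b, rfl⟩]
  | reset a =>
      refine (local_setReg (fun _ : Unit => f a) _).mono ?_
      rintro _ ⟨x, rfl⟩
      exact ⟨a, rfl⟩
  | branch reg p q hp hq =>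
      have hc : ∀ s, Local (Set.range f) (collapse (f ∘ reg) s) := fun s =>
        (local_collapse (f ∘ reg) s).mono (Set.range_comp_subset_range _ _)
      exact .sum _ fun s => .ite _ (.comp hp (hc s)) (.comp hq (hc s))
  | sample key =>
      refine .smul _ (.sum _ fun E => ?_)
      exact (local_setReg (fun x => f (key x)) _).mono
        (Set.range_comp_subset_range (fun x => key x) f)
  | apply inverse reg =>
      refine .sum _ fun t => .comp (Local.mono ?_ (local_sandwich_lift _ _))
        (Local.mono ?_ (local_collapse _ _))
      · exact Set.range_comp_subset_range (fun x => reg (Sum.inr x)) f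
      · exact Set.range_comp_subset_range (fun x => reg (Sum.inl x)) f

theorem Local.step_run {W : ℕ} (f : Fin W → G) (c : Step W) : Local (Set.range f) (c.run f) := by
  cases c with
  | gate cond g => exact local_sandwich_lift f _
  | meas v =>
      refine .sum _ fun s => (local_collapse _ s).mono ?_
      rintro _ ⟨x, rfl⟩
      exact ⟨v, rfl⟩

theorem Local.runCircuit {W : ℕ} (f : Fin W → G) (C : List (Step W)) :
    Local (Set.range f) (runCircuit f C) := by
  induction C with
  | nil => exact Local.id _
  | cons c C ih =>
      exact Local.comp (Φ := MPQC.runCircuit f C) (Ψ := c.run f) ih (Local.step_run f c)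

/-! ### Calculus of lifted operators -/

/-- Used for matrix products with lifted operators: the intermediate states that count agree with
`a` outside the lifted register, so they are parametrized by the register's content `u`. -/
theorem sum_eq_sum_extend {f : L → G} (hf : Function.Injective f) (a : G → Bool)
    (F : (G → Bool) → ℂ) (hF : ∀ c, (∃ g, g ∉ Set.range f ∧ a g ≠ c g) → F c = 0) :
    ∑ c, F c = ∑ u : L → Bool, F (Function.extend f u a) := by
  symm
  refine Fintype.sum_of_injective (fun u => Function.extend f u a) (fun u v huv => ?_) _ _
    (fun c hc => ?_) (fun u => rfl)
  · funext l
    simpa [hf.extend_apply] using congrFun huv (f l)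
  · apply hF
    by_contra! hcon
    refine hc ⟨c ∘ f, funext fun g => ?_⟩
    by_cases hg : g ∈ Set.range f
    · obtain ⟨l, rfl⟩ := hg
      simp [hf.extend_apply]
    · simpa [Function.extend_apply' _ _ _ hg] using hcon g hg

theorem lift_mul {f : L → G} (hf : Function.Injective f) (V V' : Op L) :
    lift f V * lift f V' = lift f (V * V') := by
  ext a b
  rw [Matrix.mul_apply, sum_eq_sum_extend hf a]
  · by_cases hab : ∀ g, g ∉ Set.range f → a g = b g
    · simp only [lift, if_pos hab, Matrix.mul_apply]
      refine Finset.sum_congr rfl fun u _ => ?_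
      have e : Function.extend f u a ∘ f = u := funext fun l => hf.extend_apply _ _ _
      rw [if_pos, if_pos, e]
      · intro g hg
        rw [Function.extend_apply' _ _ _ hg, hab g hg]
      · intro g hg
        rw [Function.extend_apply' _ _ _ hg]
    · have : lift f (V * V') a b = 0 := if_neg hab
      rw [this]
      refine Finset.sum_eq_zero fun u _ => mul_eq_zero_of_right _ (if_neg fun h => hab ?_)
      intro g hg
      rw [← h g hg, Function.extend_apply' _ _ _ hg]
  · rintro c ⟨g, hg, hne⟩
    exact mul_eq_zero_of_left (if_neg fun h => hne (h g hg)) _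

theorem lift_one {f : L → G} : lift f (1 : Op L) = 1 := by
  ext a b
  by_cases hab : a = b
  · subst hab
    simp only [lift, implies_true, if_true, Matrix.one_apply_eq]
  · rw [Matrix.one_apply_ne hab]
    by_cases h : ∀ g, g ∉ Set.range f → a g = b g
    · rw [lift, if_pos h]
      refine Matrix.one_apply_ne fun e => hab (funext fun g => ?_)
      by_cases hg : g ∈ Set.range f
      · obtain ⟨l, rfl⟩ := hg
        exact congrFun e l
      · exact h g hg
    · exact if_neg h

theorem lift_zero (f : L → G) : lift f (0 : Op L) = 0 := by
  ext a b
  simp [lift]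

theorem lift_conjTranspose (f : L → G) (V : Op L) : (lift f V)ᴴ = lift f Vᴴ := by
  ext a b
  simp only [Matrix.conjTranspose_apply, lift]
  rw [apply_ite star, star_zero]
  have e : (∀ g, g ∉ Set.range f → b g = a g) ↔ ∀ g, g ∉ Set.range f → a g = b g :=
    forall_congr' fun g => imp_congr_right fun _ => eq_comm
  by_cases h : ∀ g, g ∉ Set.range f → a g = b g
  · rw [if_pos (e.2 h), if_pos h]
  · rw [if_neg fun h' => h (e.1 h'), if_neg h]

theorem lift_sum (f : L → G) {ι : Type} (t : Finset ι) (V : ι → Op L) :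
    lift f (∑ i ∈ t, V i) = ∑ i ∈ t, lift f (V i) := by
  ext a b
  rw [Matrix.sum_apply]
  by_cases h : ∀ g, g ∉ Set.range f → a g = b g
  · simp only [lift, if_pos h, Matrix.sum_apply]
  · simp only [lift, if_neg h, Finset.sum_const_zero]

theorem lift_lift {N : Type} {f : L → G} (hf : Function.Injective f) (h : N → L) (V : Op N) :
    lift f (lift h V) = lift (fun x => f (h x)) V := by
  ext a b
  have e : ((∀ g, g ∉ Set.range f → a g = b g) ∧
      ∀ l, l ∉ Set.range h → (a ∘ f) l = (b ∘ f) l) ↔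
      ∀ g, g ∉ Set.range (fun x => f (h x)) → a g = b g := by
    refine ⟨fun ⟨h1, h2⟩ g hg => ?_, fun h1 => ⟨fun g hg => h1 g ?_, fun l hl => h1 _ ?_⟩⟩
    · by_cases hgf : g ∈ Set.range f
      · obtain ⟨l, rfl⟩ := hgf
        exact h2 l fun ⟨x, hx⟩ => hg ⟨x, by simp [hx]⟩
      · exact h1 g hgf
    · rintro ⟨x, rfl⟩
      exact hg ⟨_, rfl⟩
    · rintro ⟨x, hx⟩
      exact hl ⟨x, hf hx⟩
  by_cases hab : ∀ g, g ∉ Set.range (fun x => f (h x)) → a g = b g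
  · have hab' := e.2 hab
    simp only [lift, if_pos hab, if_pos hab'.1, if_pos hab'.2]
    rfl
  · simp only [lift, if_neg hab]
    split_ifs with h1 h2
    · exact absurd (e.1 ⟨h1, h2⟩) hab
    · rfl
    · rfl

theorem single_mul_single (s t u v : L → Bool) :
    (Matrix.single s t 1 : Op L) * Matrix.single u v 1 =
      if t = u then Matrix.single s v 1 else 0 := by
  split_ifs with h
  · subst h
    simp
  · exact Matrix.single_mul_single_of_ne _ _ _ _ h _

theorem lift_single_mul {f : L → G} (hf : Function.Injective f) (s t u v : L → Bool) :
    lift f (Matrix.single s t 1) * lift f (Matrix.single u v 1) =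
      if t = u then lift f (Matrix.single s v 1) else 0 := by
  rw [lift_mul hf, single_mul_single, apply_ite (lift f), lift_zero]

theorem sum_single_eq_one : ∑ s : L → Bool, (Matrix.single s s 1 : Op L) = 1 := by
  ext a b
  rw [Matrix.sum_apply]
  by_cases h : a = b
  · subst h
    simp [Matrix.single_apply]
  · rw [Matrix.one_apply_ne h]
    refine Finset.sum_eq_zero fun s _ => ?_
    rw [Matrix.single_apply, if_neg]
    rintro ⟨rfl, rfl⟩
    exact h rfl

/-! ### Measuring and overwriting a register -/

/-- The lifted projector is a diagonal matrix of zeros and ones even if `f` repeats qubits, so a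
measurement outcome masks entries, and identities between collapses can be checked entrywise without
injectivity. -/
theorem collapse_apply (f : L → G) (s : L → Bool) (ρ : Op G) (a b : G → Bool) :
    collapse f s ρ a b = if a ∘ f = s ∧ b ∘ f = s then ρ a b else 0 := by
  have : lift f (Matrix.single s s 1) =
      Matrix.diagonal fun a : G → Bool => if a ∘ f = s then (1 : ℂ) else 0 := by
    ext a b
    by_cases hab : a = b
    · subst hab
      simp [lift, Matrix.single_apply, eq_comm]
    · rw [Matrix.diagonal_apply_ne _ hab]
      by_cases h : ∀ g, g ∉ Set.range f → a g = b g
      · rw [lift, if_pos h, Matrix.single_apply, if_neg]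
        rintro ⟨h1, h2⟩
        refine hab (funext fun g => ?_)
        by_cases hg : g ∈ Set.range f
        · obtain ⟨l, rfl⟩ := hg
          exact congrFun (h1.symm.trans h2) l
        · exact h g hg
      · exact if_neg h
  rw [collapse, sandwich, this, Matrix.diagonal_conjTranspose, Matrix.mul_diagonal,
    Matrix.diagonal_mul]
  by_cases h1 : a ∘ f = s <;> by_cases h2 : b ∘ f = s <;> simp [h1, h2]

theorem collapse_collapse (f : L → G) (s t : L → Bool) (ρ : Op G) :
    collapse f s (collapse f t ρ) = if s = t then collapse f t ρ else 0 := by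
  ext a b
  split_ifs with h
  · subst h
    simp only [collapse_apply, ← ite_and, and_self]
  · simp only [collapse_apply, ← ite_and]
    rw [if_neg]
    · rfl
    · rintro ⟨⟨h1, _⟩, h2, _⟩
      exact h (h1.symm.trans h2)

theorem collapse_comp_equiv {N : Type} [Fintype N] [DecidableEq N] (f : L → G) (e : N ≃ L)
    (s : L → Bool) (ρ : Op G) : collapse (f ∘ e) (s ∘ e) ρ = collapse f s ρ := by
  ext a b
  have h : ∀ x y : L → Bool, x ∘ e = y ∘ e ↔ x = y := fun x y =>
    e.surjective.injective_comp_right.eq_iff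
  simp only [collapse_apply, ← Function.comp_assoc, h]

theorem collapse_setReg {f : L → G} (hf : Function.Injective f) (s t : L → Bool) (ρ : Op G) :
    collapse f s (setReg f t ρ) = if s = t then setReg f t ρ else 0 := by
  rw [setReg, (local_collapse f s).map_sum]
  simp only [collapse, sandwich_sandwich, lift_single_mul hf]
  split_ifs with h
  · subst h
    rfl
  · simp [zero_sandwich]

/-- On a state already projected onto `s`, only the Kraus term reading `s` survives, and it is the
projector itself. This is how a register reset to zero is identified with one never written. -/
theorem setReg_eq_self {f : L → G} (hf : Function.Injective f) (s : L → Bool) {ρ : Op G}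
    (h : collapse f s ρ = ρ) : setReg f s ρ = ρ := by
  have : setReg f s (collapse f s ρ) = collapse f s ρ := by
    rw [setReg, Finset.sum_eq_single s]
    · rw [collapse, sandwich_sandwich, lift_single_mul hf, if_pos rfl]
    · intro u _ hu
      rw [collapse, sandwich_sandwich, lift_single_mul hf, if_neg hu, zero_sandwich]
    · exact fun h => absurd (Finset.mem_univ _) h
  rwa [h] at this

/-- The product of Kraus operators behind resetting one qubit of a register with known content. -/
theorem lift_update_mul_single (l : L) (u : Unit → Bool) (s t : L → Bool) :
    lift (fun _ : Unit => l) (Matrix.single (fun _ => false) u 1) * (Matrix.single s t 1 : Op L) =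
      if s l = u () then Matrix.single (Function.update s l false) t 1 else 0 := by
  ext a b
  by_cases hb : t = b
  · subst hb
    rw [Matrix.mul_single_apply_same, mul_one]
    simp only [lift, Set.range_const, Set.mem_singleton_iff]
    have e : (s ∘ fun _ : Unit => l) = u ↔ s l = u () :=
      ⟨fun h => congrFun h (), fun h => funext fun _ => h⟩
    by_cases h1 : ∀ g, g ≠ l → a g = s g
    · rw [if_pos h1, Matrix.single_apply]
      by_cases h2 : s l = u ()
      · rw [if_pos h2, Matrix.single_apply]
        refine if_congr ⟨fun h => ⟨?_, rfl⟩, fun h => ⟨?_, (e.2 h2).symm⟩⟩ rfl rfl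
        · funext g
          by_cases hg : g = l
          · subst hg
            simpa using congrFun h.1 ()
          · rw [Function.update_of_ne hg, h1 g hg]
        · funext x
          rw [← h.1]
          simp
      · rw [if_neg h2, if_neg fun h => h2 (e.1 h.2.symm)]
        rfl
    · rw [if_neg h1]
      symm
      split_ifs with h2
      · rw [Matrix.single_apply, if_neg]
        rintro ⟨rfl, -⟩
        exact h1 fun g hg => Function.update_of_ne hg _ _
      · rfl
  · rw [Matrix.mul_single_apply_of_ne _ _ _ _ _ (Ne.symm hb)]
    split_ifs
    · rw [Matrix.single_apply, if_neg fun h => hb h.2]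
    · rfl

/-- Since the register holds `s`, the only Kraus term of the reset that contributes is the one
reading `s l`. -/
theorem reset_setReg {f : L → G} (hf : Function.Injective f) (l : L) (s : L → Bool) (ρ : Op G) :
    setReg (fun _ : Unit => f l) (fun _ => false) (setReg f s ρ) =
      setReg f (Function.update s l false) ρ := by
  rw [setReg, Finset.sum_eq_single (fun _ => s l)]
  · rw [← lift_lift hf (fun _ : Unit => l), setReg, (local_sandwich_lift f _).map_sum]
    simp only [sandwich_sandwich, lift_mul hf, lift_update_mul_single, if_true]
    rfl
  · intro u _ hu
    have hu' : ¬ s l = u () := fun h => hu (funext fun _ => h.symm)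
    rw [← lift_lift hf (fun _ : Unit => l), setReg, (local_sandwich_lift f _).map_sum]
    simp [sandwich_sandwich, lift_mul hf, lift_update_mul_single, hu', lift_zero, zero_sandwich]
  · exact fun h => absurd (Finset.mem_univ _) h

/-! ### Discarding qubits -/

/-- Cyclicity of the trace and commutation of `M` with `K i` collect the factors `(K i)ᴴ * K i`,
which sum to the identity: a channel on qubits that are not observed cannot be noticed. -/
theorem trace_mul_sum_sandwich {s t : Set G} (hst : Disjoint s t) {M : Op G} (hM : ActsOn s M)
    {ι : Type} [Fintype ι] (K : ι → Op G) (hK : ∀ i, ActsOn t (K i))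
    (hsum : ∑ i, (K i)ᴴ * K i = 1) (ρ : Op G) :
    (M * ∑ i, sandwich (K i) ρ).trace = (M * ρ).trace := by
  have h : ∀ i, (M * sandwich (K i) ρ).trace = ((K i)ᴴ * K i * (M * ρ)).trace := fun i => by
    rw [sandwich, ← Matrix.mul_assoc, Matrix.trace_mul_comm, ← Matrix.mul_assoc M,
      ActsOn.commute hst hM (hK i)]
    simp only [Matrix.mul_assoc]
  rw [Finset.mul_sum, Matrix.trace_sum, Finset.sum_congr rfl fun i _ => h i, ← Matrix.trace_sum,
    ← Finset.sum_mul, hsum, one_mul]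

theorem trace_mul_sum_collapse {s : Set G} {M : Op G} (hM : ActsOn s M) {f : L → G}
    (hf : Function.Injective f) (hst : Disjoint s (Set.range f)) (ρ : Op G) :
    (M * ∑ t, collapse f t ρ).trace = (M * ρ).trace := by
  refine trace_mul_sum_sandwich hst hM _ (fun t => actsOn_lift f _) ?_ ρ
  simp only [lift_conjTranspose, Matrix.conjTranspose_single, star_one, lift_single_mul hf,
    if_true, ← lift_sum, sum_single_eq_one, lift_one]

theorem trace_mul_setReg {s : Set G} {M : Op G} (hM : ActsOn s M) {f : L → G}
    (hf : Function.Injective f) (hst : Disjoint s (Set.range f)) (u : L → Bool) (ρ : Op G) :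
    (M * setReg f u ρ).trace = (M * ρ).trace := by
  refine trace_mul_sum_sandwich hst hM _ (fun t => actsOn_lift f _) ?_ ρ
  simp only [lift_conjTranspose, Matrix.conjTranspose_single, star_one, lift_single_mul hf,
    if_true, ← lift_sum, sum_single_eq_one, lift_one]

theorem trace_mul_sandwich {s t : Set G} (hst : Disjoint s t) {M : Op G} (hM : ActsOn s M)
    {K : Op G} (hK : ActsOn t K) (hKK : Kᴴ * K = 1) (ρ : Op G) :
    (M * sandwich K ρ).trace = (M * ρ).trace := by
  simpa using trace_mul_sum_sandwich hst hM (fun _ : Unit => K) (fun _ => hK) (by simpa using hKK) ρ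

theorem mul_lift_single_apply {f : L → G} (hf : Function.Injective f) (M : Op G)
    (s t : L → Bool) (a b : G → Bool) :
    (M * lift f (Matrix.single s t 1)) a b =
      if b ∘ f = t then M a (Function.extend f s b) else 0 := by
  have e : ∀ u, Function.extend f u b ∘ f = u := fun u => funext fun l => hf.extend_apply _ _ _
  have e' : ∀ u, ∀ g, g ∉ Set.range f → Function.extend f u b g = b g := fun u g hg =>
    Function.extend_apply' _ _ _ hg
  rw [Matrix.mul_apply, sum_eq_sum_extend hf b, Finset.sum_eq_single s]
  · rw [lift, if_pos (e' s), e, Matrix.single_apply]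
    by_cases h : b ∘ f = t
    · rw [if_pos ⟨rfl, h.symm⟩, if_pos h, mul_one]
    · rw [if_neg fun h' => h h'.2.symm, if_neg h, mul_zero]
  · intro u _ hu
    rw [lift, if_pos (e' u), e, Matrix.single_apply, if_neg fun h' => hu h'.1.symm, mul_zero]
  · exact fun h => absurd (Finset.mem_univ _) h
  · rintro c ⟨g, hg, hne⟩
    exact mul_eq_zero_of_right _ (if_neg fun h => hne (h g hg).symm)

/-- After the qubits `f l` have been erased, an observable cannot see a unitary acting on them and
on qubits outside its support. -/
theorem trace_mul_setReg_sandwich {s t : Set G} {M : Op G} (hM : ActsOn s M) {f : L → G}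
    (hf : Function.Injective f) (hst : Disjoint (s \ Set.range f) t) {K : Op G}
    (hK : ActsOn t K) (hKK : Kᴴ * K = 1) (u : L → Bool) (ρ : Op G) :
    (M * setReg f u (sandwich K ρ)).trace = (M * setReg f u ρ).trace := by
  -- `N` is the observable in the Heisenberg picture, pulled back through the erasure. It no longer
  -- depends on the erased qubits, so `K` may act on them.
  set N : Op G := ∑ v, (lift f (Matrix.single u v 1))ᴴ * (M * lift f (Matrix.single u v 1)) with hN
  have dual : ∀ σ, (M * setReg f u σ).trace = (N * σ).trace := fun σ => by
    rw [setReg, Finset.mul_sum, Matrix.trace_sum, hN, Finset.sum_mul, Matrix.trace_sum]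
    refine Finset.sum_congr rfl fun v _ => ?_
    rw [sandwich, ← Matrix.mul_assoc, Matrix.trace_mul_comm]
    simp only [Matrix.mul_assoc]
  -- `N` is the block of `M` with the erased qubits fixed to `u`, tensored with the identity on
  -- these qubits.
  have entry : ∀ a b, N a b = if a ∘ f = b ∘ f then
      M (Function.extend f u a) (Function.extend f u b) else 0 := fun a b => by
    have h1 : ∀ v (X : Op G), ((lift f (Matrix.single u v 1))ᴴ * X) a b =
        if a ∘ f = v then X (Function.extend f u a) b else 0 := fun v X => by
      have := congrArg star (mul_lift_single_apply hf Xᴴ u v b a)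
      rw [← Matrix.conjTranspose_apply, Matrix.conjTranspose_mul,
        Matrix.conjTranspose_conjTranspose] at this
      rw [this]
      split_ifs <;> simp
    rw [hN, Matrix.sum_apply, Finset.sum_eq_single (a ∘ f)]
    · rw [h1, if_pos rfl, mul_lift_single_apply hf]
      exact if_congr eq_comm rfl rfl
    · intro v _ hv
      rw [h1, if_neg (Ne.symm hv)]
    · exact fun h => absurd (Finset.mem_univ _) h
  have acts : ActsOn (s \ Set.range f) N := by
    refine ⟨fun a b hab g hg => ?_, fun a b a' b' h1 h2 h3 h4 => ?_⟩
    · rw [entry] at hab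
      split_ifs at hab with h
      · by_cases hgf : g ∈ Set.range f
        · obtain ⟨l, rfl⟩ := hgf
          exact congrFun h l
        · have := hM.1 _ _ hab (show g ∈ sᶜ from fun hs => hg ⟨hs, hgf⟩)
          rwa [Function.extend_apply' _ _ _ hgf, Function.extend_apply' _ _ _ hgf] at this
      · exact absurd rfl hab
    · have e1 : a ∘ f = b ∘ f := funext fun l => h1 fun h => h.2 ⟨l, rfl⟩
      have e2 : a' ∘ f = b' ∘ f := funext fun l => h2 fun h => h.2 ⟨l, rfl⟩
      rw [entry, entry, if_pos e1, if_pos e2]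
      have aux : ∀ {x y : G → Bool} {v : Set G}, Set.EqOn x y (v \ Set.range f) →
          Set.EqOn (Function.extend f u x) (Function.extend f u y) v := by
        intro x y v hxy g hg
        by_cases hgf : g ∈ Set.range f
        · obtain ⟨l, rfl⟩ := hgf
          rw [hf.extend_apply, hf.extend_apply]
        · rw [Function.extend_apply' _ _ _ hgf, Function.extend_apply' _ _ _ hgf]
          exact hxy ⟨hg, hgf⟩
      exact hM.2 _ _ _ _ (aux fun g hg => h1 fun h => hg.1 h.1)
        (aux fun g hg => h2 fun h => hg.1 h.1) (aux h3) (aux h4)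
  rw [dual, dual, trace_mul_sandwich hst acts hK hKK]

end Support

/-! ### Adding qubits in the state zero -/

section Extend
variable {L G H : Type} [Fintype L] [DecidableEq L] [Fintype G] [DecidableEq G] [Fintype H]
  [DecidableEq H]

/-- The isometry that adds all qubits outside the range of `f`, in the state zero. -/
def zeroExt (f : G → H) : Matrix (H → Bool) (G → Bool) ℂ := fun a b =>
  if a = Function.extend f b (fun _ => false) then 1 else 0

theorem eq_extend_false_iff {f : G → H} (hf : Function.Injective f) (a : H → Bool)
    (b : G → Bool) : a = Function.extend f b (fun _ => false) ↔
      (∀ g, g ∉ Set.range f → a g = false) ∧ a ∘ f = b := by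
  constructor
  · rintro rfl
    exact ⟨fun g hg => Function.extend_apply' _ _ _ hg, funext fun l => hf.extend_apply _ _ _⟩
  · rintro ⟨h, rfl⟩
    funext g
    by_cases hg : g ∈ Set.range f
    · obtain ⟨l, rfl⟩ := hg
      rw [hf.extend_apply]
      rfl
    · rw [Function.extend_apply' _ _ _ hg, h g hg]

theorem mul_zeroExt_apply (f : G → H) (K : Op H) (a : H → Bool) (b : G → Bool) :
    (K * zeroExt f) a b = K a (Function.extend f b fun _ => false) := by
  simp [Matrix.mul_apply, zeroExt]

open Classical in
theorem zeroExt_mul_apply {f : G → H} (hf : Function.Injective f) {ι : Type}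
    (K : Matrix (G → Bool) ι ℂ) (a : H → Bool) (b : ι) :
    (zeroExt f * K) a b = if ∀ g, g ∉ Set.range f → a g = false then K (a ∘ f) b else 0 := by
  simp only [Matrix.mul_apply, zeroExt, eq_extend_false_iff hf, ite_and, ite_mul, one_mul, zero_mul]
  split_ifs <;> simp

theorem conjTranspose_zeroExt_mul_zeroExt {f : G → H} (hf : Function.Injective f) :
    (zeroExt f)ᴴ * zeroExt f = 1 := by
  ext a b
  have h : Function.extend f a (fun _ => false) = Function.extend f b (fun _ => false) ↔ a = b :=
    ⟨fun h => funext fun l => by simpa [hf.extend_apply] using congrFun h (f l), fun h => by rw [h]⟩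
  simp [Matrix.mul_apply, zeroExt, Matrix.one_apply, h, eq_comm]

/-- As conjugation by an isometry, adding qubits is compatible with a Kraus term as soon as the
operators satisfy `K * zeroExt f = zeroExt f * K'`. -/
theorem prepare_eq {f : G → H} (hf : Function.Injective f) (ρ : Op G) :
    prepare f ρ = zeroExt f * ρ * (zeroExt f)ᴴ := by
  ext a b
  -- Taking adjoints moves the right factor to the left, so that `zeroExt_mul_apply` computes both
  -- sides.
  have h : (zeroExt f * ρ * (zeroExt f)ᴴ) a b = star ((zeroExt f * (zeroExt f * ρ)ᴴ) b a) := by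
    rw [← Matrix.conjTranspose_apply, Matrix.conjTranspose_mul, Matrix.conjTranspose_conjTranspose]
  rw [h, zeroExt_mul_apply hf]
  by_cases ha : ∀ g, g ∉ Set.range f → a g = false
  · by_cases hb : ∀ g, g ∉ Set.range f → b g = false
    · rw [prepare, if_pos fun g hg => ⟨ha g hg, hb g hg⟩, if_pos hb, Matrix.conjTranspose_apply,
        star_star, zeroExt_mul_apply hf, if_pos ha]
    · rw [prepare, if_neg fun h => hb fun g hg => (h g hg).2, if_neg hb, star_zero]
  · rw [prepare, if_neg fun h => ha fun g hg => (h g hg).1, Matrix.conjTranspose_apply,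
      zeroExt_mul_apply hf, if_neg ha]
    simp

theorem prepare_prepare {f : G → H} (hf : Function.Injective f) (g : L → G) (ρ : Op L) :
    prepare f (prepare g ρ) = prepare (fun x => f (g x)) ρ := by
  ext a b
  have e : (∀ y, y ∉ Set.range (fun x => f (g x)) → a y = false ∧ b y = false) ↔
      (∀ y, y ∉ Set.range f → a y = false ∧ b y = false) ∧
        ∀ x, x ∉ Set.range g → (a ∘ f) x = false ∧ (b ∘ f) x = false := by
    refine ⟨fun h => ⟨fun y hy => h y ?_, fun x hx => h (f x) ?_⟩, fun ⟨h1, h2⟩ y hy => ?_⟩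
    · rintro ⟨x, rfl⟩
      exact hy ⟨_, rfl⟩
    · rintro ⟨z, hz⟩
      exact hx ⟨z, hf hz⟩
    · by_cases hyf : y ∈ Set.range f
      · obtain ⟨x, rfl⟩ := hyf
        exact h2 x fun ⟨z, hz⟩ => hy ⟨z, by simp [hz]⟩
      · exact h1 y hyf
  by_cases h : ∀ y, y ∉ Set.range (fun x => f (g x)) → a y = false ∧ b y = false
  · simp only [prepare, if_pos h, if_pos (e.1 h).1, if_pos (e.1 h).2]
    rfl
  · simp only [prepare, if_neg h]
    split_ifs with h1 h2
    · exact absurd (e.2 ⟨h1, h2⟩) h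
    · rfl
    · rfl

theorem collapse_prepare {f : L → H} {g : G → H} (hfg : Disjoint (Set.range f) (Set.range g))
    (ρ : Op G) : collapse f (fun _ => false) (prepare g ρ) = prepare g ρ := by
  ext a b
  rw [collapse_apply]
  by_cases h : ∀ y, y ∉ Set.range g → a y = false ∧ b y = false
  · rw [if_pos]
    exact ⟨funext fun l => (h _ (Set.disjoint_left.1 hfg ⟨l, rfl⟩)).1,
      funext fun l => (h _ (Set.disjoint_left.1 hfg ⟨l, rfl⟩)).2⟩
  · rw [prepare, if_neg h, ite_self]

variable {f : G → H} (hf : Function.Injective f)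
include hf

theorem isLinearMap_prepare : IsLinearMap ℂ (prepare (G := H) f) :=
  ⟨fun ρ σ => by simp [prepare_eq hf, Matrix.mul_add, Matrix.add_mul],
    fun c ρ => by simp [prepare_eq hf]⟩

theorem prepare_sum {ι : Type} (t : Finset ι) (ρ : ι → Op G) :
    prepare f (∑ i ∈ t, ρ i) = ∑ i ∈ t, prepare f (ρ i) :=
  map_sum (IsLinearMap.mk' _ (isLinearMap_prepare hf)) ρ t

theorem sandwich_prepare {K : Op H} {K' : Op G} (h : K * zeroExt f = zeroExt f * K') (ρ : Op G) :
    sandwich K (prepare f ρ) = prepare f (sandwich K' ρ) := by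
  have h' : (zeroExt f)ᴴ * Kᴴ = K'ᴴ * (zeroExt f)ᴴ := by
    rw [← Matrix.conjTranspose_mul, h, Matrix.conjTranspose_mul]
  rw [prepare_eq hf, prepare_eq hf, sandwich, sandwich]
  simp only [← Matrix.mul_assoc]
  rw [h]
  simp only [Matrix.mul_assoc]
  rw [h']

theorem lift_mul_zeroExt (g : L → G) (V : Op L) :
    lift (fun x => f (g x)) V * zeroExt f = zeroExt f * lift g V := by
  ext a b
  rw [mul_zeroExt_apply, zeroExt_mul_apply hf]
  have e2 : (Function.extend f b fun _ => false) ∘ f = b := funext fun l => hf.extend_apply _ _ _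
  have e : (∀ y, y ∉ Set.range (fun x => f (g x)) → a y = Function.extend f b (fun _ => false) y) ↔
      (∀ y, y ∉ Set.range f → a y = false) ∧ ∀ x, x ∉ Set.range g → (a ∘ f) x = b x := by
    refine ⟨fun h => ⟨fun y hy => ?_, fun x hx => ?_⟩, fun ⟨h1, h2⟩ y hy => ?_⟩
    · rw [h y, Function.extend_apply' _ _ _ hy]
      rintro ⟨x, rfl⟩
      exact hy ⟨_, rfl⟩
    · rw [Function.comp_apply, h (f x), hf.extend_apply]
      rintro ⟨z, hz⟩
      exact hx ⟨z, hf hz⟩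
    · by_cases hyf : y ∈ Set.range f
      · obtain ⟨x, rfl⟩ := hyf
        rw [hf.extend_apply]
        exact h2 x fun ⟨z, hz⟩ => hy ⟨z, by simp [hz]⟩
      · rw [Function.extend_apply' _ _ _ hyf, h1 y hyf]
  by_cases h : (∀ y, y ∉ Set.range f → a y = false) ∧ ∀ x, x ∉ Set.range g → (a ∘ f) x = b x
  · simp only [lift, if_pos (e.2 h), if_pos h.1, if_pos h.2]
    congr 1
    exact funext fun x => hf.extend_apply _ _ _
  · simp only [lift, if_neg fun h' => h (e.1 h')]
    split_ifs with h1 h2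
    · exact absurd ⟨h1, h2⟩ h
    · rfl
    · rfl

theorem cnotOp_mul_zeroExt (x y : G) :
    cnotOp (f x) (f y) * zeroExt f = zeroExt f * cnotOp x y := by
  ext a b
  rw [mul_zeroExt_apply, zeroExt_mul_apply hf]
  have e : a = Function.update (Function.extend f b fun _ => false) (f y)
      (xor (Function.extend f b (fun _ => false) (f y))
        (Function.extend f b (fun _ => false) (f x))) ↔
      (∀ y, y ∉ Set.range f → a y = false) ∧
        a ∘ f = Function.update b y (xor (b y) (b x)) := by
    rw [← eq_extend_false_iff hf, hf.extend_apply, hf.extend_apply]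
    suffices h : ∀ v, Function.update (Function.extend f b fun _ => false) (f y) v =
        Function.extend f (Function.update b y v) fun _ => false by rw [h]
    intro v
    refine (eq_extend_false_iff hf _ _).2 ⟨fun g hg => ?_, funext fun l => ?_⟩
    · rw [Function.update_of_ne fun h => hg ⟨y, h.symm⟩, Function.extend_apply' _ _ _ hg]
    · by_cases hl : l = y
      · subst hl
        simp
      · simp [hl, hf.eq_iff, hf.extend_apply]
  simp only [cnotOp, e, ite_and]

theorem collapse_comp_prepare (g : L → G) (s : L → Bool) (ρ : Op G) :
    collapse (fun x => f (g x)) s (prepare f ρ) = prepare f (collapse g s ρ) :=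
  sandwich_prepare hf (lift_mul_zeroExt hf g _) ρ

theorem setReg_comp_prepare (g : L → G) (s : L → Bool) (ρ : Op G) :
    setReg (fun x => f (g x)) s (prepare f ρ) = prepare f (setReg g s ρ) := by
  simp only [setReg, prepare_sum hf]
  exact Finset.sum_congr rfl fun t _ => sandwich_prepare hf (lift_mul_zeroExt hf g _) ρ

/-- No instruction touches the added qubits, so each one intertwines with the isometry. -/
theorem prog_run_prepare {N : Type} (g : N → G) (p : Prog N) (ρ : Op G) :
    p.run (fun x => f (g x)) (prepare f ρ) = prepare f (p.run g ρ) := by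
  induction p generalizing ρ with
  | skip => rfl
  | seq p q hp hq => simp only [Prog.run, hp, hq]
  | gate a u => exact sandwich_prepare hf (lift_mul_zeroExt hf (fun _ : Unit => g a) _) ρ
  | cnot a b h => exact sandwich_prepare hf (cnotOp_mul_zeroExt hf (g a) (g b)) ρ
  | reset a => exact setReg_comp_prepare hf (fun _ : Unit => g a) _ ρ
  | branch reg p q hp hq =>
      simp only [Prog.run, prepare_sum hf]
      refine Finset.sum_congr rfl fun s _ => ?_
      have := collapse_comp_prepare hf (g ∘ reg) s ρ
      simp only [Function.comp_def] at this ⊢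
      rw [this, hp, hq, apply_ite (prepare f)]
  | sample key =>
      simp only [Prog.run, (isLinearMap_prepare hf).map_smul, prepare_sum hf]
      congr 1
      exact Finset.sum_congr rfl fun E _ => setReg_comp_prepare hf (fun x => g (key x)) _ ρ
  | apply inverse reg =>
      simp only [Prog.run, prepare_sum hf]
      refine Finset.sum_congr rfl fun t _ => ?_
      rw [collapse_comp_prepare hf (fun x => g (reg (Sum.inl x)))]
      exact sandwich_prepare hf (lift_mul_zeroExt hf (fun x => g (reg (Sum.inr x))) _) _

theorem runCircuit_prepare {W : ℕ} (g : Fin W → G) (C : List (Step W)) (ρ : Op G) :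
    runCircuit (fun v => f (g v)) C (prepare f ρ) = prepare f (runCircuit g C ρ) := by
  induction C generalizing ρ with
  | nil => rfl
  | cons c C ih =>
      have : c.run (fun v => f (g v)) (prepare f ρ) = prepare f (c.run g ρ) := by
        cases c with
        | gate cond u => exact sandwich_prepare hf (lift_mul_zeroExt hf g _) ρ
        | meas v =>
            simp only [Step.run, prepare_sum hf]
            exact Finset.sum_congr rfl fun s _ =>
              collapse_comp_prepare hf (fun _ : Unit => g v) s ρ
      simp only [runCircuit, List.foldl_cons, this] at ih ⊢
      exact ih _

theorem trace_lift_mul_prepare (g : L → G) (M : Op L) (ρ : Op G) :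
    (lift (fun x => f (g x)) M * prepare f ρ).trace = (lift g M * ρ).trace := by
  rw [prepare_eq hf, ← Matrix.mul_assoc, ← Matrix.mul_assoc, lift_mul_zeroExt hf,
    Matrix.trace_mul_comm, Matrix.mul_assoc, ← Matrix.mul_assoc,
    conjTranspose_zeroExt_mul_zeroExt hf, one_mul]

end Extend

/-! ### Building programs -/

namespace Prog
variable {L N : Type}

/-- Rename the qubits of a program. -/
def map (φ : L ↪ N) : Prog L → Prog N
  | .skip => .skip
  | .seq p q => .seq (p.map φ) (q.map φ)
  | .gate a u => .gate (φ a) u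
  | .cnot a b h => .cnot (φ a) (φ b) (φ.injective.ne h)
  | .reset a => .reset (φ a)
  | .branch reg p q => .branch (φ ∘ reg) (p.map φ) (q.map φ)
  | .sample key => .sample (key.trans φ)
  | .apply inverse reg => .apply inverse (reg.trans φ)

theorem cost_map (φ : L ↪ N) (p : Prog L) : (p.map φ).cost = p.cost := by
  induction p with
  | seq p q hp hq => simp only [map, cost, hp, hq]
  | branch reg p q hp hq => simp only [map, cost, hp, hq]
  | _ => rfl

/-- The unitary bit flip. -/
def flip : Matrix.unitaryGroup Bool ℂ :=
  ⟨pauli true false, by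
    rw [Matrix.mem_unitaryGroup_iff]
    ext a b
    change ∑ c, pauli true false a c * star (pauli true false b c) = _
    cases a <;> cases b <;> simp [pauli]⟩

/-- Put a qubit into the state one. -/
def setOne (a : L) : Prog L := .seq (.reset a) (.gate a flip)

/-- Reset the qubits in a list. -/
def resetList : List L → Prog L
  | [] => .skip
  | a :: l => .seq (.reset a) (resetList l)

theorem cost_resetList (l : List L) : (resetList l).cost = l.length := by
  induction l with
  | nil => rfl
  | cons a l ih => simp only [resetList, cost, ih, List.length_cons, add_comm]

variable {G : Type} [Fintype G] [DecidableEq G]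

theorem run_map (φ : L ↪ N) (f : N → G) (p : Prog L) (ρ : Op G) :
    (p.map φ).run f ρ = p.run (fun x => f (φ x)) ρ := by
  induction p generalizing ρ with
  | seq p q hp hq => simp only [map, run, hp, hq]
  | branch reg p q hp hq =>
      simp only [map, run, hp, hq]
      rfl
  | _ => rfl

theorem run_setOne (f : L → G) (a : L) (ρ : Op G) :
    (setOne a).run f ρ = setReg (fun _ : Unit => f a) (fun _ => true) ρ := by
  have hf : Function.Injective fun _ : Unit => f a := fun _ _ _ => rfl
  set V : Op Unit := fun x y => flip.1 (x ()) (y ()) with hV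
  change sandwich (lift (fun _ : Unit => f a) V) (∑ t, _) = ∑ t, _
  rw [(local_sandwich_lift (fun _ : Unit => f a) V).map_sum]
  refine Finset.sum_congr rfl fun t _ => ?_
  rw [sandwich_sandwich, lift_mul hf]
  congr 2
  ext x y
  by_cases hy : t = y
  · subst hy
    rw [Matrix.mul_single_apply_same, mul_one, Matrix.single_apply]
    rcases hx : x () with _ | _
    · rw [if_neg fun h => by simpa [hx] using congrFun h.1 ()]
      simp [hV, flip, pauli, hx]
    · rw [if_pos ⟨funext fun _ => hx.symm, rfl⟩]
      simp [hV, flip, pauli, hx]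
  · rw [Matrix.mul_single_apply_of_ne _ _ _ _ _ (Ne.symm hy), Matrix.single_apply,
      if_neg fun h => hy h.2]

theorem run_resetList_setReg {K : Type} [Fintype K] [DecidableEq K] {f : K → G}
    (hf : Function.Injective f) (l : List K) (s : K → Bool) (ρ : Op G) :
    (resetList l).run f (setReg f s ρ) = setReg f (fun x => if x ∈ l then false else s x) ρ := by
  induction l generalizing s with
  | nil => simp [resetList, run]
  | cons x l ih =>
      simp only [resetList, run]
      rw [reset_setReg hf, ih]
      congr 1
      funext y
      by_cases h : y = x <;> by_cases h' : y ∈ l <;> simp [h, h']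

/-- `Prog.branch` numbers its measured qubits, whereas abort bits are indexed by corrupted players;
the condition that all outcomes are zero does not depend on the numbering. -/
theorem run_branch_equiv {B : Type} [Fintype B] [DecidableEq B] {c : ℕ} (e : Fin c ≃ B)
    (f : L → G) (reg : B → L) (p q : Prog L) (ρ : Op G) :
    (branch (fun x => reg (e x)) p q).run f ρ =
      ∑ s : B → Bool, if s = fun _ => false then p.run f (collapse (fun x => f (reg x)) s ρ)
        else q.run f (collapse (fun x => f (reg x)) s ρ) := by
  simp only [run]
  refine (Fintype.sum_equiv (e.arrowCongr (Equiv.refl Bool)).symm _ _ fun s => ?_).symm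
  have h1 : (e.arrowCongr (Equiv.refl Bool)).symm s = s ∘ e := rfl
  have h2 : s ∘ e = (fun _ => false) ↔ s = fun _ => false :=
    e.surjective.injective_comp_right.eq_iff (b := fun _ => false)
  have h3 := collapse_comp_equiv (fun x => f (reg x)) e s ρ
  rw [h1]
  simp only [h2]
  rw [← h3]
  rfl

end Prog

/-! ### Abort bits received by the ideal functionality -/

section AbortBits
variable {B G : Type} [Fintype B] [DecidableEq B] [Fintype G] [DecidableEq G]

/-- Measure the qubits `bit j` and apply `ab` unless all outcomes are zero. -/
def abortUnlessZero (bit : B → G) (ab : Op G → Op G) (ρ : Op G) : Op G :=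
  ∑ b : B → Bool, if b = fun _ => false then collapse bit b ρ else ab (collapse bit b ρ)

theorem disjoint_range {α β γ : Type} {f : α → γ} {g : β → γ} (h : ∀ x y, f x ≠ g y) :
    Disjoint (Set.range f) (Set.range g) := by
  rw [Set.disjoint_left]
  rintro _ ⟨x, rfl⟩ ⟨y, hy⟩
  exact h x y hy.symm

variable {t : Set G} {bit : B → G} {ab : Op G → Op G} (hab : Local t ab)
include hab

theorem local_abortUnlessZero : Local (Set.range bit ∪ t) (abortUnlessZero bit ab) :=
  .sum _ fun b =>
    have h := (local_collapse bit b).mono Set.subset_union_left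
    .ite _ h (.comp (hab.mono Set.subset_union_right) h)

theorem abortUnlessZero_of_collapse (s : B → Bool) {ρ : Op G} (h : collapse bit s ρ = ρ) :
    abortUnlessZero bit ab ρ = if s = fun _ => false then ρ else ab ρ := by
  rw [abortUnlessZero, Finset.sum_eq_single s]
  · rw [h]
  · intro b _ hb
    rw [← h, collapse_collapse, if_neg hb, hab.map_zero, ite_self]
  · exact fun h => absurd (Finset.mem_univ _) h

/-- The outcome zero carries no weight, so `ab` may be applied in every branch. It then commutes
with the measurement, which nobody observes. -/
theorem trace_mul_abortUnlessZero {s : Set G} {M : Op G} (hM : ActsOn s M)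
    (hbit : Function.Injective bit) (hs : Disjoint s (Set.range bit))
    (ht : Disjoint (Set.range bit) t) {ρ : Op G} (h : collapse bit (fun _ => false) ρ = 0) :
    (M * abortUnlessZero bit ab ρ).trace = (M * ab ρ).trace := by
  rw [← trace_mul_sum_collapse hM hbit hs (ab ρ), abortUnlessZero]
  congr 2
  refine Finset.sum_congr rfl fun b _ => ?_
  rw [Local.commute ht (local_collapse bit b) hab]
  split_ifs with hb
  · rw [hb, h, hab.map_zero]
  · rfl

end AbortBits

variable {P : Task}

/-- Real-world qubits that the simulator keeps in its own workspace. -/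
def RealReg.Extra {r q : ℕ} : RealReg P r q → Prop
  | .trap _ | .key _ => P.i ∈ P.corrupt
  | .work _ | .mpcBit _ | .status => True
  | _ => False

namespace Adversary
variable {r : ℕ} (A : Adversary P r)

/-! ### The simulator -/

/-- Size of the workspace of the simulator. -/
def extraQubits : ℕ := Nat.card {x : RealReg P r A.work // x.Extra}

/-- The workspace qubits of the simulator stand for the qubits it has to provide. -/
def extraEquiv : Fin A.extraQubits ≃ {x : RealReg P r A.work // x.Extra} :=
  (Finite.equivFin _).symm

/-- The real-world qubit represented by an ideal-world qubit. -/
def toReal : IdealReg P r A.extraQubits → RealReg P r A.work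
  | .wire v => .wire v
  | .side x => .side x
  | .work x => (A.extraEquiv x).1
  | .bit j => .bit j
  | .flag j => .flag j

theorem toReal_injective : Function.Injective A.toReal := by
  intro x y h
  cases x <;> cases y <;> simp only [toReal] at h
  case work.work x y => rw [A.extraEquiv.injective (Subtype.ext h)]
  -- A workspace qubit stands for one satisfying `Extra`, which is false for the qubits represented
  -- by the other constructors.
  case work.wire x y => exact absurd (A.extraEquiv x).2 (h ▸ id)
  case work.side x y => exact absurd (A.extraEquiv x).2 (h ▸ id)
  case work.bit x y => exact absurd (A.extraEquiv x).2 (h ▸ id)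
  case work.flag x y => exact absurd (A.extraEquiv x).2 (h ▸ id)
  case wire.work x y => exact absurd (A.extraEquiv y).2 (h ▸ id)
  case side.work x y => exact absurd (A.extraEquiv y).2 (h ▸ id)
  case bit.work x y => exact absurd (A.extraEquiv y).2 (h ▸ id)
  case flag.work x y => exact absurd (A.extraEquiv y).2 (h ▸ id)
  all_goals cases h
  all_goals rfl

theorem exists_work_of_extra {x : RealReg P r A.work} (hx : x.Extra) :
    ∃ y, A.toReal (.work y) = x :=
  ⟨A.extraEquiv.symm ⟨x, hx⟩, by simp [toReal]⟩

theorem exists_held₀ {x : RealReg P r A.work} (hx : x.Held₀) :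
    ∃ y : {y : IdealReg P r A.extraQubits // y.Held₀}, A.toReal y.1 = x := by
  cases x with
  | wire v => exact ⟨⟨.wire v, hx⟩, rfl⟩
  | side v => exact ⟨⟨.side v, trivial⟩, rfl⟩
  | work v =>
      obtain ⟨y, hy⟩ := A.exists_work_of_extra (x := .work v) trivial
      exact ⟨⟨.work y, trivial⟩, hy⟩
  | _ => exact hx.elim

/-- Real-world qubits that the adversary holds after the circuit has been applied. -/
abbrev Late : Type := {x : RealReg P r A.work // x.Held₁ ∨ x.Held₂}

/-- After the circuit the simulator runs only once, while the adversary acts in two stages with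
different registers; the simulator therefore needs the qubits of both stages at the same time. -/
theorem exists_held₁ {x : RealReg P r A.work} (hx : x.Held₁ ∨ x.Held₂) :
    ∃ y : {y : IdealReg P r A.extraQubits // y.Held₁}, A.toReal y.1 = x := by
  have extra : x.Extra → ∃ y : {y : IdealReg P r A.extraQubits // y.Held₁}, A.toReal y.1 = x :=
    fun h => by
      obtain ⟨y, hy⟩ := A.exists_work_of_extra h
      exact ⟨⟨.work y, trivial⟩, hy⟩
  cases x with
  | wire v => exact ⟨⟨.wire v, hx.elim id id⟩, rfl⟩
  | side v => exact ⟨⟨.side v, trivial⟩, rfl⟩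
  | bit v => exact ⟨⟨.bit v, trivial⟩, rfl⟩
  | trap v => exact extra (hx.elim id id)
  | work v => exact extra trivial
  | mpcBit v => exact extra trivial
  | status => exact extra trivial
  | key v => exact extra (hx.elim False.elim id)
  | flag v => exact (hx.elim id id : False).elim

/-- The ideal-world representative of a qubit held before the inputs are sent. -/
def embed₀ : {x : RealReg P r A.work // x.Held₀} ↪
    {y : IdealReg P r A.extraQubits // y.Held₀} where
  toFun x := (A.exists_held₀ x.2).choose
  inj' x y h := Subtype.ext <| by
    rw [← (A.exists_held₀ x.2).choose_spec, ← (A.exists_held₀ y.2).choose_spec]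
    exact congrArg (fun z => A.toReal z.1) h

/-- The ideal-world representative of a qubit held after the circuit has been applied. -/
def embed₁ : A.Late ↪ {y : IdealReg P r A.extraQubits // y.Held₁} where
  toFun x := (A.exists_held₁ x.2).choose
  inj' x y h := Subtype.ext <| by
    rw [← (A.exists_held₁ x.2).choose_spec, ← (A.exists_held₁ y.2).choose_spec]
    exact congrArg (fun z => A.toReal z.1) h

theorem toReal_embed₀ (x) : A.toReal (A.embed₀ x).1 = x.1 := (A.exists_held₀ x.2).choose_spec

theorem toReal_embed₁ (x) : A.toReal (A.embed₁ x).1 = x.1 := (A.exists_held₁ x.2).choose_spec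

/-- The key register, held if player `i` is corrupted. -/
def keyReg (hi : P.i ∈ P.corrupt) : KeyBit (P.n + 1) ↪ A.Late where
  toFun x := ⟨.key x, Or.inr hi⟩
  inj' x y h := by simpa using h

/-- The key register and the encoded output, held if player `i` is corrupted. -/
def keyCodeReg (hi : P.i ∈ P.corrupt) : KeyBit (P.n + 1) ⊕ Fin (P.n + 1) ↪ A.Late where
  toFun
    | .inl x => ⟨.key x, Or.inr hi⟩
    | .inr x => ⟨Fin.cases (.wire P.w) (fun t => .trap t) x, Or.inl <| by
        cases x using Fin.cases with
        | zero => exact ⟨rfl, hi⟩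
        | succ t => exact hi⟩
  inj' x y h := by
    rcases x with x | x <;> rcases y with y | y
    · simpa using h
    · cases y using Fin.cases <;> simp at h
    · cases x using Fin.cases <;> simp at h
    · cases x using Fin.cases <;> cases y using Fin.cases <;> simp at h ⊢
      exact h

/-- If player `i` is corrupted, encode the output under a fresh random key. -/
def encodeProg : Prog A.Late :=
  if hi : P.i ∈ P.corrupt then .seq (.sample (A.keyReg hi)) (.apply false (A.keyCodeReg hi))
  else .skip

/-- Erase the key if player `i` is corrupted. -/
def forgetProg : Prog A.Late :=
  if hi : P.i ∈ P.corrupt then (Prog.resetList Finset.univ.toList).map (A.keyReg hi) else .skip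

/-- The adversary's last program. -/
def keyProg : Prog A.Late :=
  A.onKey.map (Subtype.impEmbedding _ _ fun _ h => Or.inr h)

open Classical in
/-- Send a nonzero abort bit to the ideal functionality. -/
def raiseProg : Prog A.Late :=
  -- One nonzero bit suffices. Without corrupted players there are no bits to measure, so the branch
  -- containing this program never occurs.
  if h : Nonempty P.Bad then Prog.setOne ⟨.bit h.some, Or.inl trivial⟩ else .skip

/-- The simulation of the decoding protocol when the state register contains the key. -/
def acceptProg : Prog A.Late :=
  .seq A.keyProg <| .branch
    (fun x => ⟨.mpcBit ((Fintype.equivFin P.Bad).symm x), Or.inr trivial⟩) .skip A.raiseProg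

/-- The simulation of the decoding protocol when the state register contains `⊥`. -/
def rejectProg : Prog A.Late :=
  -- With `⊥` in the state register the real adversary never receives the key, so the simulated key
  -- must disappear before the last program runs.
  .seq A.forgetProg <| .seq (Prog.setOne ⟨.status, Or.inr trivial⟩) A.keyProg

/-- The simulator's program after it has received the outputs of the corrupted players. -/
def outputProg : Prog A.Late :=
  .seq A.encodeProg <|
    .seq (A.onEncoded.map (Subtype.impEmbedding _ _ fun _ h => Or.inl h)) <| .branch
      (fun x => ⟨.bit ((Fintype.equivFin P.Bad).symm x), Or.inl trivial⟩)
      A.acceptProg A.rejectProg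

/-- The simulator. -/
def simulator : Simulator P r where
  work := A.extraQubits
  onInput := A.onInput.map A.embed₀
  onOutput := A.outputProg.map A.embed₁

/-! ### Complexity of the simulator -/

/-- `toReal` sends qubits held by the simulator injectively to qubits the adversary holds at some
stage. -/
theorem card_held_simulator_le :
    Nat.card {x : IdealReg P r A.simulator.work // x.Held₀ ∨ x.Held₁} ≤
      Nat.card {x : RealReg P r A.work // x.Held₀ ∨ x.Held₁ ∨ x.Held₂} := by
  have key : ∀ y : IdealReg P r A.extraQubits, y.Held₀ ∨ y.Held₁ →
      (A.toReal y).Held₀ ∨ (A.toReal y).Held₁ ∨ (A.toReal y).Held₂ := by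
    intro y hy
    cases y with
    | wire v => exact hy.elim Or.inl fun h => Or.inr (Or.inl h)
    | side v => exact Or.inl trivial
    | bit v => exact Or.inr (Or.inl trivial)
    | flag v => exact (hy.elim id id : False).elim
    | work v =>
        have h := (A.extraEquiv v).2
        change ((A.extraEquiv v).1).Held₀ ∨ ((A.extraEquiv v).1).Held₁ ∨ ((A.extraEquiv v).1).Held₂
        revert h
        generalize (A.extraEquiv v).1 = x
        intro h
        cases x with
        | trap _ => exact Or.inr (Or.inl h)
        | key _ => exact Or.inr (Or.inr h)
        | work _ => exact Or.inl trivial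
        | mpcBit _ => exact Or.inr (Or.inr trivial)
        | status => exact Or.inr (Or.inr trivial)
        | _ => exact h.elim
  exact Nat.card_le_card_of_injective
    (fun y => (⟨A.toReal y.1, key y.1 y.2⟩ :
      {x : RealReg P r A.work // x.Held₀ ∨ x.Held₁ ∨ x.Held₂}))
    fun y z h => Subtype.ext (A.toReal_injective (congrArg Subtype.val h))

theorem card_le_complexity {ι : Type} (f : ι → RealReg P r A.work) (hf : Function.Injective f)
    (h : ∀ x, (f x).Held₀ ∨ (f x).Held₁ ∨ (f x).Held₂) : Nat.card ι ≤ A.complexity :=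
  (Nat.card_le_card_of_injective
    (fun x => (⟨f x, h x⟩ : {x : RealReg P r A.work // x.Held₀ ∨ x.Held₁ ∨ x.Held₂}))
    fun _ _ h => hf (congrArg Subtype.val h)).trans (Nat.le_add_right _ _)

theorem cost_encodeProg_le : A.encodeProg.cost ≤ 2 * (A.complexity + 1) ^ 3 := by
  unfold encodeProg
  split_ifs with hi
  -- The `n + 1` code qubits are held by the adversary when player `i` is corrupted. Sampling and
  -- applying an `(n + 1)`-qubit Clifford cost `(n + 2) ^ 3` each.
  · have h : P.n + 1 ≤ A.complexity := by
      have := A.card_le_complexity (fun x => ((A.keyCodeReg hi) (.inr x)).1)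
        (fun x y h => Sum.inr_injective ((A.keyCodeReg hi).injective (Subtype.ext h)))
        fun x => Or.inr ((A.keyCodeReg hi) (.inr x)).2
      simpa using this
    simp only [Prog.cost]
    have := Nat.pow_le_pow_left (Nat.add_le_add_right h 1) 3
    omega
  · exact Nat.zero_le _

theorem cost_forgetProg_le : A.forgetProg.cost ≤ A.complexity := by
  unfold forgetProg
  split_ifs with hi
  · rw [Prog.cost_map, Prog.cost_resetList, Finset.length_toList, Finset.card_univ,
      ← Nat.card_eq_fintype_card]
    exact A.card_le_complexity (fun x => (A.keyReg hi x).1)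
      (fun x y h => (A.keyReg hi).injective (Subtype.ext h)) fun x => Or.inr (A.keyReg hi x).2
  · exact Nat.zero_le _

/-- The linear term covers the qubits and the adversary's programs, a second copy of `onKey` (one in
each branch), the two measurements of `P.Bad` bits and the erasure of the key, with some slack. The
constant pays for the two uses of `setOne`. -/
theorem complexity_simulator_le :
    A.simulator.complexity ≤ 2 * (A.complexity + 1) ^ 3 + 6 * A.complexity + 4 := by
  have hbad : Fintype.card P.Bad ≤ A.complexity := by
    rw [← Nat.card_eq_fintype_card]
    exact A.card_le_complexity (fun j => .bit j) (fun i j h => by simpa using h)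
      fun j => Or.inr (Or.inl trivial)
  have h1 := A.card_held_simulator_le
  have h2 := A.cost_encodeProg_le
  have h3 := A.cost_forgetProg_le
  have h4 : A.raiseProg.cost ≤ 2 := by
    unfold raiseProg
    split_ifs
    · exact le_rfl
    · exact Nat.zero_le _
  have h5 : A.complexity = Nat.card {x : RealReg P r A.work // x.Held₀ ∨ x.Held₁ ∨ x.Held₂}
    + (A.onInput.cost + A.onEncoded.cost + A.onKey.cost) := rfl
  have h6 : A.simulator.onInput.cost = A.onInput.cost := Prog.cost_map _ _
  have h7 : A.simulator.onOutput.cost = A.outputProg.cost := Prog.cost_map _ _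
  rw [Simulator.complexity, h6, h7]
  simp only [outputProg, acceptProg, rejectProg, keyProg, Prog.setOne, Prog.cost, Prog.cost_map]
  omega

end Adversary

/-! ### Cliffords -/

/-- Both sides are the same classical choice, so the unitaries agree exactly and not only up to a
phase. -/
theorem describedUnitary_bits {m : ℕ} (E : CliffordKey m) :
    describedUnitary E.bits = E.unitary := by
  have h : ∃ U, Describes E.bits U := E.2
  rw [describedUnitary, dif_pos h]
  rfl

theorem CliffordKey.unitary_mem {m : ℕ} (E : CliffordKey m) :
    E.unitary ∈ Matrix.unitaryGroup (Fin m → Bool) ℂ :=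
  (Classical.choose_spec E.2).1.1

instance (m : ℕ) : Nonempty (CliffordKey m) :=
  -- The tableau of the identity: each generator is its own image.
  ⟨⟨fun x => decide (x.2 = some x.1), 1,
    ⟨one_mem _, fun s => ⟨s, by simp⟩⟩, fun g => by simp [pauliGen]⟩⟩

theorem CliffordKey.smul_sum_const {m : ℕ} (x : ℂ) :
    (Fintype.card (CliffordKey m) : ℂ)⁻¹ * ∑ _E : CliffordKey m, x = x := by
  rw [Finset.sum_const, Finset.card_univ, nsmul_eq_mul, inv_mul_cancel_left₀]
  exact Nat.cast_ne_zero.2 Fintype.card_ne_zero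

namespace Adversary
variable {P : Task} {r : ℕ} (A : Adversary P r) (e : ℕ)

/-! ### Registers of the real world -/

/-- The bits sent to the functionality without decoding. -/
abbrev bitQ : P.Bad → A.Global e := fun j => Sum.inl (.bit j)

/-- The bits sent to the classical MPC. -/
abbrev mpcQ : P.Bad → A.Global e := fun j => Sum.inl (.mpcBit j)

/-- The register receiving the key. -/
abbrev keyQ : KeyBit (P.n + 1) → A.Global e := fun x => Sum.inl (.key x)

/-- The trap qubits. -/
abbrev trapQ : Fin P.n → A.Global e := fun x => Sum.inl (.trap x)

/-- The wires that the circuit has measured. -/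
abbrev restQ : {v : Fin P.W // v ≠ P.w} → A.Global e := fun v => Sum.inl (.wire v.1)

/-- The qubits that the environment prepares. -/
def inputQ : P.InputWire ⊕ Fin r ⊕ Fin e → A.Global e
  | .inl v => .inl (.wire v.1)
  | .inr (.inl x) => .inl (.side x)
  | .inr (.inr x) => .inr x

/-- The qubits that the environment measures. -/
def outputQ : Unit ⊕ P.Good ⊕ Fin r ⊕ Fin e → A.Global e
  | .inl _ => .inl (.wire P.w)
  | .inr (.inl j) => .inl (.flag j)
  | .inr (.inr (.inl x)) => .inl (.side x)
  | .inr (.inr (.inr x)) => .inr x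

/-- The qubits that are overwritten when the honest players abort. -/
def abortSet : Set (A.Global e) :=
  {g | (∃ j, g = Sum.inl (.flag j)) ∨ P.i ∉ P.corrupt ∧ g = Sum.inl (.wire P.w)}

/-- Inputs of corrupted players and application of the circuit. -/
def circuitRun (ρ : Op (A.Global e)) : Op (A.Global e) :=
  runCircuit (fun v => Sum.inl (.wire v)) P.C (A.onInput.run (fun x => Sum.inl x.1) ρ)

/-- The adversary's action on the encoded output. -/
abbrev encodedRun : Op (A.Global e) → Op (A.Global e) := A.onEncoded.run fun x => Sum.inl x.1

/-- The adversary's action on the answer of the classical MPC. -/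
abbrev keyRun : Op (A.Global e) → Op (A.Global e) := A.onKey.run fun x => Sum.inl x.1

/-- Tell the adversary that the state register contains `⊥`. -/
abbrev setStatus : Op (A.Global e) → Op (A.Global e) :=
  setReg (fun _ : Unit => Sum.inl .status) fun _ => true

theorem code_injective : Function.Injective (A.code e) := by
  intro x y h
  cases x using Fin.cases <;> cases y using Fin.cases <;> simp [code] at h ⊢
  exact h

theorem keyQ_injective : Function.Injective (A.keyQ e) := fun x y h => by simpa using h

theorem bitQ_injective : Function.Injective (A.bitQ e) := fun x y h => by simpa using h

theorem mpcQ_injective : Function.Injective (A.mpcQ e) := fun x y h => by simpa using h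

theorem restQ_injective : Function.Injective (A.restQ e) :=
  fun x y h => Subtype.ext (by simpa using h)

theorem local_keyRun :
    Local (Set.range fun x : {x : RealReg P r A.work // x.Held₂} => (Sum.inl x.1 : A.Global e))
      (A.keyRun e) := Local.prog_run _ _

theorem local_encodedRun :
    Local (Set.range fun x : {x : RealReg P r A.work // x.Held₁} => (Sum.inl x.1 : A.Global e))
      (A.encodedRun e) := Local.prog_run _ _

theorem local_abort : Local (A.abortSet e) (A.abort e) := by
  have h1 : Local (A.abortSet e)
      (setReg (fun j : P.Good => (Sum.inl (.flag j) : A.Global e)) fun _ => true) :=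
    (local_setReg _ _).mono (by rintro _ ⟨j, rfl⟩; exact Or.inl ⟨j, rfl⟩)
  unfold abort
  by_cases hi : P.i ∈ P.corrupt
  · simpa only [if_pos hi] using h1
  · simp only [if_neg hi]
    exact .comp ((local_setReg _ _).mono (by rintro _ ⟨j, rfl⟩; exact Or.inr ⟨hi, rfl⟩)) h1

theorem disjoint_held₂ {L : Type} (f : L → RealReg P r A.work) (h : ∀ x, ¬ (f x).Held₂) :
    Disjoint (Set.range fun x => (Sum.inl (f x) : A.Global e))
      (Set.range fun x : {x : RealReg P r A.work // x.Held₂} => (Sum.inl x.1 : A.Global e)) :=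
  disjoint_range fun x y hxy => h x (Sum.inl_injective hxy ▸ y.2)

theorem disjoint_held₁ {L : Type} (f : L → RealReg P r A.work) (h : ∀ x, ¬ (f x).Held₁) :
    Disjoint (Set.range fun x => (Sum.inl (f x) : A.Global e))
      (Set.range fun x : {x : RealReg P r A.work // x.Held₁} => (Sum.inl x.1 : A.Global e)) :=
  disjoint_range fun x y hxy => h x (Sum.inl_injective hxy ▸ y.2)

theorem disjoint_abortSet {L : Type} (f : L → RealReg P r A.work) (h : ∀ x j, f x ≠ .flag j)
    (hw : P.i ∉ P.corrupt → ∀ x, f x ≠ .wire P.w) :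
    Disjoint (Set.range fun x => (Sum.inl (f x) : A.Global e)) (A.abortSet e) := by
  rw [Set.disjoint_left]
  rintro _ ⟨x, rfl⟩ (⟨j, hj⟩ | ⟨hi, hx⟩)
  · exact h x j (Sum.inl_injective hj)
  · exact hw hi x (Sum.inl_injective hx)

theorem disjoint_outputQ {L : Type} (f : L → RealReg P r A.work) (h1 : ∀ x, f x ≠ .wire P.w)
    (h2 : ∀ x j, f x ≠ .flag j) (h3 : ∀ x j, f x ≠ .side j) :
    Disjoint (Set.range (A.outputQ e)) (Set.range fun x => (Sum.inl (f x) : A.Global e)) := by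
  refine disjoint_range fun y x h => ?_
  rcases y with y | y | y | y <;> simp only [outputQ] at h
  · exact h1 x (Sum.inl_injective h).symm
  · exact h2 x _ (Sum.inl_injective h).symm
  · exact h3 x _ (Sum.inl_injective h).symm
  · cases h

theorem collapse_circuitRun {L : Type} [Fintype L] [DecidableEq L] (f : L → RealReg P r A.work)
    (h1 : ∀ x, ¬ (f x).Held₀) (h2 : ∀ x v, f x ≠ .wire v) (s : L → Bool) (ρ : Op (A.Global e)) :
    collapse (fun x => (Sum.inl (f x) : A.Global e)) s (A.circuitRun e ρ) =
      A.circuitRun e (collapse (fun x => Sum.inl (f x)) s ρ) := by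
  have d1 : Disjoint (Set.range fun x => (Sum.inl (f x) : A.Global e))
      (Set.range fun v : Fin P.W => (Sum.inl (.wire v) : A.Global e)) :=
    disjoint_range fun x v h => h2 x v (Sum.inl_injective h)
  have d2 : Disjoint (Set.range fun x => (Sum.inl (f x) : A.Global e))
      (Set.range fun x : {x : RealReg P r A.work // x.Held₀} => (Sum.inl x.1 : A.Global e)) :=
    disjoint_range fun x y hxy => h1 x (Sum.inl_injective hxy ▸ y.2)
  rw [circuitRun, Local.commute d1 (local_collapse _ _) (Local.runCircuit _ _),
    Local.commute d2 (local_collapse _ _) (Local.prog_run _ _)]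
  rfl

theorem collapse_prepare_inputQ {L : Type} [Fintype L] [DecidableEq L]
    (f : L → RealReg P r A.work) (h1 : ∀ x v, f x ≠ .wire v) (h2 : ∀ x j, f x ≠ .side j)
    (ρ : Op (P.InputWire ⊕ Fin r ⊕ Fin e)) :
    collapse (fun x => (Sum.inl (f x) : A.Global e)) (fun _ => false) (prepare (A.inputQ e) ρ) =
      prepare (A.inputQ e) ρ := by
  refine collapse_prepare (disjoint_range fun x y h => ?_) ρ
  rcases y with y | y | y <;> simp only [inputQ] at h
  · exact h1 x _ (Sum.inl_injective h)
  · exact h2 x _ (Sum.inl_injective h)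
  · cases h

/-! ### The real experiment -/

theorem local_decode (E : CliffordKey (P.n + 1)) :
    Local (Set.range (A.restQ e))ᶜ (A.decode e E) := by
  have hab : Local (Set.range (A.restQ e))ᶜ (A.abort e) := by
    refine (A.local_abort e).mono ?_
    rintro _ (⟨j, rfl⟩ | ⟨-, rfl⟩) ⟨v, hv⟩
    · cases hv
    · exact v.2 (by simpa using hv)
  unfold decode
  refine .ite _ (.id _) (.sum _ fun t => ?_)
  have h : Local (Set.range (A.restQ e))ᶜ fun ρ => collapse (A.trapQ e) t
      (sandwich (lift (A.code e) (E.unitary)ᴴ) ρ) := by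
    refine .comp ((local_collapse _ _).mono ?_) ((local_sandwich_lift _ _).mono ?_)
    · rintro _ ⟨x, rfl⟩ ⟨v, hv⟩
      cases hv
    · rintro _ ⟨x, rfl⟩ ⟨v, hv⟩
      cases x using Fin.cases with
      | zero => exact v.2 (by simpa [code] using hv)
      | succ t => simp [code] at hv
  exact .ite _ h (.comp hab h)

/-- After the functionality without decoding, no party acts on a wire other than `w`. Hence the
measurement of these wires can be postponed to the end, where it is not observed. -/
theorem local_decodingProtocol (s : StateReg P) :
    Local (Set.range (A.restQ e))ᶜ (A.decodingProtocol e s) := by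
  have hab : Local (Set.range (A.restQ e))ᶜ (A.abort e) := by
    refine (A.local_abort e).mono ?_
    rintro _ (⟨j, rfl⟩ | ⟨-, rfl⟩) ⟨v, hv⟩
    · cases hv
    · exact v.2 (by simpa using hv)
  have hK : Local (Set.range (A.restQ e))ᶜ (A.keyRun e) := by
    refine (A.local_keyRun e).mono ?_
    rintro _ ⟨⟨x, hx⟩, rfl⟩ ⟨v, hv⟩
    cases hv
    exact v.2 hx.1
  have hm : ∀ b, Local (Set.range (A.restQ e))ᶜ (collapse (A.mpcQ e) b) := fun b => by
    refine (local_collapse _ _).mono ?_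
    rintro _ ⟨x, rfl⟩ ⟨v, hv⟩
    cases hv
  rcases s with _ | ⟨E, o⟩
  · refine .sum _ fun b => .comp hab (.comp (hm b) (.comp hK ((local_setReg _ _).mono ?_)))
    rintro _ ⟨x, rfl⟩ ⟨v, hv⟩
    cases hv
  · have h : ∀ b, Local (Set.range (A.restQ e))ᶜ fun ρ => collapse (A.mpcQ e) b
        (A.keyRun e (if P.i ∈ P.corrupt then setReg (A.keyQ e) E.bits ρ else ρ)) := fun b => by
      refine .comp (hm b) (.comp hK (.ite _ ((local_setReg _ _).mono ?_) (.id _)))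
      rintro _ ⟨x, rfl⟩ ⟨v, hv⟩
      cases hv
    exact .sum _ fun b => .ite _ (.comp (A.local_decode e E) (h b)) (.comp hab (h b))

section Trace
variable {M : Op (A.Global e)} (hM : ActsOn (Set.range (A.outputQ e)) M)
include hM

/-- On `⊥` the honest players abort whatever the adversary answers, so measuring its answer has no
visible effect. -/
theorem trace_decodingProtocol_none (ρ : Op (A.Global e)) :
    (M * A.decodingProtocol e none ρ).trace =
      (M * A.abort e (A.keyRun e (A.setStatus e ρ))).trace := by
  have d : Disjoint (Set.range (A.mpcQ e)) (A.abortSet e) :=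
    A.disjoint_abortSet e _ (by simp) (by simp)
  have h : A.decodingProtocol e none ρ =
      ∑ b, collapse (A.mpcQ e) b (A.abort e (A.keyRun e (A.setStatus e ρ))) :=
    Finset.sum_congr rfl fun b _ =>
      (Local.commute d (local_collapse _ b) (A.local_abort e) _).symm
  rw [h, trace_mul_sum_collapse hM (A.mpcQ_injective e)]
  exact A.disjoint_outputQ e _ (by simp) (by simp) (by simp)

/-- The protocol ignores the stored outcomes, so the value `fun _ => false` on the right is an
arbitrary placeholder; the projections move to the end and sum to an unobserved measurement. -/
theorem trace_sum_decodingProtocol_some (E : CliffordKey (P.n + 1)) (ρ : Op (A.Global e)) :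
    ∑ o, (M * A.decodingProtocol e (some (E, o)) (collapse (A.restQ e) o ρ)).trace =
      (M * A.decodingProtocol e (some (E, fun _ => false)) ρ).trace := by
  rw [← Matrix.trace_sum, ← Finset.mul_sum]
  have h : ∀ o, A.decodingProtocol e (some (E, o)) (collapse (A.restQ e) o ρ) =
      collapse (A.restQ e) o (A.decodingProtocol e (some (E, fun _ => false)) ρ) := fun o =>
    (Local.commute disjoint_compl_right (local_collapse _ _) (A.local_decodingProtocol e _) ρ).symm
  rw [Finset.sum_congr rfl fun o _ => h o, trace_mul_sum_collapse hM (A.restQ_injective e)]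
  refine A.disjoint_outputQ e _ (fun v hv => v.2 ?_) (by simp) (by simp)
  simpa using hv

/-- Normal form of the real experiment: for each key, one accepting term and one term per nonzero
bit string. `trace_abortUnlessZero_outputProg` brings the simulated experiment into the same shape.
-/
theorem trace_real (ρ : Op (A.Global e)) :
    (M * ∑ s, A.decodingProtocol e s (A.idealWithoutDecoding e ρ s)).trace =
      (Fintype.card (CliffordKey (P.n + 1)) : ℂ)⁻¹ * ∑ E : CliffordKey (P.n + 1),
        ((M * A.decodingProtocol e (some (E, fun _ => false))
            (collapse (A.bitQ e) (fun _ => false) (A.afterEncoding e E ρ))).trace +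
          ∑ b ∈ (Finset.univ : Finset (P.Bad → Bool)).erase (fun _ => false),
            (M * A.abort e (A.keyRun e (A.setStatus e
              (collapse (A.bitQ e) b (A.afterEncoding e E ρ))))).trace) := by
  rw [Fintype.sum_option, Matrix.mul_add, Matrix.trace_add, Finset.sum_add_distrib, mul_add,
    add_comm]
  congr 1
  · rw [Fintype.sum_prod_type, Finset.mul_sum, Matrix.trace_sum, Finset.mul_sum]
    refine Finset.sum_congr rfl fun E _ => ?_
    rw [← A.trace_sum_decodingProtocol_some e hM E, Finset.mul_sum, Matrix.trace_sum,
      Finset.mul_sum]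
    refine Finset.sum_congr rfl fun o _ => ?_
    rw [idealWithoutDecoding, (A.local_decodingProtocol e _).map_smul, Matrix.mul_smul,
      Matrix.trace_smul, smul_eq_mul]
  · rw [idealWithoutDecoding, (A.local_decodingProtocol e _).map_smul, Matrix.mul_smul,
      Matrix.trace_smul, smul_eq_mul, (A.local_decodingProtocol e _).map_sum, Finset.mul_sum,
      Matrix.trace_sum]
    congr 1
    refine Finset.sum_congr rfl fun E _ => ?_
    rw [(A.local_decodingProtocol e _).map_sum, Finset.mul_sum, Matrix.trace_sum]
    exact Finset.sum_congr rfl fun b _ => A.trace_decodingProtocol_none e hM _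

end Trace

end Adversary

theorem collapse_false_setReg_true {B G : Type} [Fintype B] [DecidableEq B] [Fintype G]
    [DecidableEq G] (f : B → G) (j : B) (ρ : Op G) :
    collapse f (fun _ => false) (setReg (fun _ : Unit => f j) (fun _ => true) ρ) = 0 := by
  have h := collapse_setReg (f := fun _ : Unit => f j) (fun _ _ _ => rfl) (fun _ => true)
    (fun _ => true) ρ
  rw [if_pos rfl] at h
  rw [← h]
  ext a b
  rw [collapse_apply, collapse_apply, ← ite_and]
  refine if_neg ?_
  rintro ⟨⟨h1, -⟩, h2, -⟩
  have e1 : a (f j) = false := congrFun h1 j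
  have e2 : a (f j) = true := congrFun h2 ()
  exact absurd (e1.symm.trans e2) Bool.false_ne_true

namespace Adversary
variable {P : Task} {r : ℕ} (A : Adversary P r) (e : ℕ)

/-! ### The simulated experiment on the registers of the real world -/

/-- The qubits that the adversary holds after the circuit has been applied. -/
abbrev lateQ : A.Late → A.Global e := fun x => Sum.inl x.1

/-- Run of the program that erases the key. -/
abbrev forgetRun : Op (A.Global e) → Op (A.Global e) := A.forgetProg.run (A.lateQ e)

/-- Run of the program that sends a nonzero abort bit. -/
abbrev raiseRun : Op (A.Global e) → Op (A.Global e) := A.raiseProg.run (A.lateQ e)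

/-- The experiment with the simulator, on the registers of the real world. -/
def simulatedRun (ρ : Op (A.Global e)) : Op (A.Global e) :=
  abortUnlessZero (A.bitQ e) (A.abort e) (A.outputProg.run (A.lateQ e) (A.circuitRun e ρ))

theorem run_keyProg (ρ : Op (A.Global e)) : A.keyProg.run (A.lateQ e) ρ = A.keyRun e ρ :=
  Prog.run_map _ _ _ _

theorem run_acceptProg (ρ : Op (A.Global e)) : A.acceptProg.run (A.lateQ e) ρ =
    ∑ m : P.Bad → Bool, if m = fun _ => false then collapse (A.mpcQ e) m (A.keyRun e ρ)
      else A.raiseRun e (collapse (A.mpcQ e) m (A.keyRun e ρ)) := by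
  rw [acceptProg, Prog.run, run_keyProg,
    Prog.run_branch_equiv (Fintype.equivFin P.Bad).symm (A.lateQ e)
      (fun j => (⟨.mpcBit j, Or.inr trivial⟩ : A.Late))]
  rfl

theorem run_rejectProg (ρ : Op (A.Global e)) : A.rejectProg.run (A.lateQ e) ρ =
    A.keyRun e (A.setStatus e (A.forgetRun e ρ)) := by
  simp only [rejectProg, Prog.run]
  rw [run_keyProg, Prog.run_setOne]

theorem run_outputProg (ρ : Op (A.Global e)) :
    A.outputProg.run (A.lateQ e) ρ = ∑ s : P.Bad → Bool, if s = fun _ => false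
      then A.acceptProg.run (A.lateQ e) (collapse (A.bitQ e) s
        (A.encodedRun e (A.encodeProg.run (A.lateQ e) ρ)))
      else A.rejectProg.run (A.lateQ e) (collapse (A.bitQ e) s
        (A.encodedRun e (A.encodeProg.run (A.lateQ e) ρ))) := by
  rw [outputProg, Prog.run, Prog.run, Prog.run_map,
    Prog.run_branch_equiv (Fintype.equivFin P.Bad).symm (A.lateQ e)
      (fun j => (⟨.bit j, Or.inl trivial⟩ : A.Late))]
  rfl

theorem local_forgetRun : Local (Set.range (A.keyQ e)) (A.forgetRun e) := by
  unfold forgetRun forgetProg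
  split_ifs with hi
  · have h := Local.prog_run (A.keyQ e) (Prog.resetList Finset.univ.toList)
    have h' : (Prog.run (A.lateQ e) ((Prog.resetList Finset.univ.toList).map (A.keyReg hi))) =
        Prog.run (A.keyQ e) (Prog.resetList Finset.univ.toList) :=
      funext fun ρ => Prog.run_map (A.keyReg hi) (A.lateQ e) _ ρ
    rwa [h']
  · exact .id _

theorem forgetRun_setReg (hi : P.i ∈ P.corrupt) (s : KeyBit (P.n + 1) → Bool)
    (ρ : Op (A.Global e)) :
    A.forgetRun e (setReg (A.keyQ e) s ρ) = setReg (A.keyQ e) (fun _ => false) ρ := by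
  rw [forgetRun, forgetProg, dif_pos hi, Prog.run_map]
  refine (Prog.run_resetList_setReg (A.keyQ_injective e) _ _ _).trans ?_
  simp

/-- A nonzero outcome witnesses that some player is corrupted, so there is a bit to raise. -/
theorem raiseRun_eq {m : P.Bad → Bool} (hm : m ≠ fun _ => false) :
    ∃ j, ∀ ρ, A.raiseRun e ρ = setReg (fun _ : Unit => A.bitQ e j) (fun _ => true) ρ := by
  have hne : Nonempty P.Bad := by
    by_contra h
    exact hm (funext fun j => absurd ⟨j⟩ h)
  refine ⟨hne.some, fun ρ => ?_⟩
  rw [raiseRun, raiseProg, dif_pos hne, Prog.run_setOne]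

theorem disjoint_bitQ_abortSet : Disjoint (Set.range (A.bitQ e)) (A.abortSet e) :=
  A.disjoint_abortSet e _ (by simp) (by simp)

theorem disjoint_outputQ_bitQ : Disjoint (Set.range (A.outputQ e)) (Set.range (A.bitQ e)) :=
  A.disjoint_outputQ e _ (by simp) (by simp) (by simp)

theorem collapse_bitQ_keyRun (s : P.Bad → Bool) (ρ : Op (A.Global e)) :
    collapse (A.bitQ e) s (A.keyRun e ρ) = A.keyRun e (collapse (A.bitQ e) s ρ) :=
  Local.commute (A.disjoint_held₂ e _ fun _ => id) (local_collapse _ _) (A.local_keyRun e) ρ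

theorem collapse_bitQ_mpcQ (s m : P.Bad → Bool) (ρ : Op (A.Global e)) :
    collapse (A.bitQ e) s (collapse (A.mpcQ e) m ρ) =
      collapse (A.mpcQ e) m (collapse (A.bitQ e) s ρ) :=
  Local.commute (disjoint_range fun x y h => by cases h) (local_collapse _ _) (local_collapse _ _) ρ

theorem collapse_bitQ_setStatus (s : P.Bad → Bool) (ρ : Op (A.Global e)) :
    collapse (A.bitQ e) s (A.setStatus e ρ) = A.setStatus e (collapse (A.bitQ e) s ρ) :=
  Local.commute (disjoint_range fun x y h => by cases h) (local_collapse _ _) (local_setReg _ _) ρ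

theorem collapse_bitQ_forgetRun (s : P.Bad → Bool) (ρ : Op (A.Global e)) :
    collapse (A.bitQ e) s (A.forgetRun e ρ) = A.forgetRun e (collapse (A.bitQ e) s ρ) :=
  Local.commute (disjoint_range fun x y h => by cases h) (local_collapse _ _)
    (A.local_forgetRun e) ρ

section Trace
variable {M : Op (A.Global e)} (hM : ActsOn (Set.range (A.outputQ e)) M)
include hM

/-- The raised bit rules out the outcome zero and forces the abort. Writing it commutes with the
abort and concerns a qubit the environment never sees. -/
theorem trace_abort_raiseRun {m : P.Bad → Bool} (hm : m ≠ fun _ => false) (ρ : Op (A.Global e)) :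
    (M * abortUnlessZero (A.bitQ e) (A.abort e) (A.raiseRun e ρ)).trace =
      (M * A.abort e ρ).trace := by
  obtain ⟨j, hj⟩ := A.raiseRun_eq e hm
  have d1 : Disjoint (Set.range fun _ : Unit => A.bitQ e j) (A.abortSet e) :=
    A.disjoint_abortSet e _ (by simp) (by simp)
  have d2 : Disjoint (Set.range (A.outputQ e)) (Set.range fun _ : Unit => A.bitQ e j) :=
    A.disjoint_outputQ e _ (by simp) (by simp) (by simp)
  rw [trace_mul_abortUnlessZero (A.local_abort e) hM (A.bitQ_injective e)
    (A.disjoint_outputQ_bitQ e) (A.disjoint_bitQ_abortSet e), hj,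
    ← Local.commute d1 (local_setReg _ _) (A.local_abort e),
    trace_mul_setReg hM (fun _ _ _ => rfl) d2]
  rw [hj]
  exact collapse_false_setReg_true (A.bitQ e) j ρ

/-- The adversary's last program does not hold the bits for the functionality. They stay zero unless
the simulator raises one, so delivery is decided by the bits for the classical MPC. -/
theorem trace_abortUnlessZero_acceptProg {ρ : Op (A.Global e)}
    (hρ : collapse (A.bitQ e) (fun _ => false) ρ = ρ) :
    (M * abortUnlessZero (A.bitQ e) (A.abort e) (A.acceptProg.run (A.lateQ e) ρ)).trace =
      ∑ m : P.Bad → Bool, (M * if m = fun _ => false then collapse (A.mpcQ e) m (A.keyRun e ρ)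
        else A.abort e (collapse (A.mpcQ e) m (A.keyRun e ρ))).trace := by
  have hL := local_abortUnlessZero (bit := A.bitQ e) (A.local_abort e)
  rw [run_acceptProg, hL.map_sum, Finset.mul_sum, Matrix.trace_sum]
  refine Finset.sum_congr rfl fun m _ => ?_
  split_ifs with hm
  · have h : collapse (A.bitQ e) (fun _ => false) (collapse (A.mpcQ e) m (A.keyRun e ρ)) =
        collapse (A.mpcQ e) m (A.keyRun e ρ) := by
      rw [collapse_bitQ_mpcQ, collapse_bitQ_keyRun, hρ]
    rw [abortUnlessZero_of_collapse (A.local_abort e) (fun _ => false) h, if_pos rfl]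
  · exact A.trace_abort_raiseRun e hM hm _

omit hM in
theorem abortUnlessZero_rejectProg {s : P.Bad → Bool} (hs : s ≠ fun _ => false)
    {ρ : Op (A.Global e)} (hρ : collapse (A.bitQ e) s ρ = ρ) :
    abortUnlessZero (A.bitQ e) (A.abort e) (A.rejectProg.run (A.lateQ e) ρ) =
      A.abort e (A.keyRun e (A.setStatus e (A.forgetRun e ρ))) := by
  have h : collapse (A.bitQ e) s (A.keyRun e (A.setStatus e (A.forgetRun e ρ))) =
      A.keyRun e (A.setStatus e (A.forgetRun e ρ)) := by
    rw [collapse_bitQ_keyRun, collapse_bitQ_setStatus, collapse_bitQ_forgetRun, hρ]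
  rw [run_rejectProg, abortUnlessZero_of_collapse (A.local_abort e) s h, if_neg hs]

theorem trace_abortUnlessZero_outputProg {ρ σ : Op (A.Global e)}
    (hσ : A.encodedRun e (A.encodeProg.run (A.lateQ e) ρ) = σ) :
    (M * abortUnlessZero (A.bitQ e) (A.abort e) (A.outputProg.run (A.lateQ e) ρ)).trace =
      ∑ m : P.Bad → Bool, (M * if m = fun _ => false
        then collapse (A.mpcQ e) m (A.keyRun e (collapse (A.bitQ e) (fun _ => false) σ))
        else A.abort e (collapse (A.mpcQ e) m
          (A.keyRun e (collapse (A.bitQ e) (fun _ => false) σ)))).trace +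
      ∑ s ∈ (Finset.univ : Finset (P.Bad → Bool)).erase (fun _ => false),
        (M * A.abort e (A.keyRun e (A.setStatus e (A.forgetRun e
          (collapse (A.bitQ e) s σ))))).trace := by
  have hL := local_abortUnlessZero (bit := A.bitQ e) (A.local_abort e)
  rw [run_outputProg, hσ, hL.map_sum, Finset.mul_sum, Matrix.trace_sum,
    ← Finset.add_sum_erase _ _ (Finset.mem_univ (fun _ : P.Bad => false)), if_pos rfl,
    A.trace_abortUnlessZero_acceptProg e hM]
  · refine congrArg _ (Finset.sum_congr rfl fun s hs => ?_)
    have hs' := Finset.ne_of_mem_erase hs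
    rw [if_neg hs', A.abortUnlessZero_rejectProg e hs']
    rw [collapse_collapse, if_pos rfl]
  · rw [collapse_collapse, if_pos rfl]

/-! ### Player `i` is corrupted -/

omit hM in
-- `Prog.apply` measures the key register, but after sampling its content is definite: for each `E`
-- only the outcome `E.bits` survives.
theorem run_encodeProg_of_mem (hi : P.i ∈ P.corrupt) (ρ : Op (A.Global e)) :
    A.encodeProg.run (A.lateQ e) ρ = (Fintype.card (CliffordKey (P.n + 1)) : ℂ)⁻¹ •
      ∑ E : CliffordKey (P.n + 1),
        sandwich (lift (A.code e) E.unitary) (setReg (A.keyQ e) E.bits ρ) := by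
  rw [encodeProg, dif_pos hi, Prog.run, Prog.run, Prog.run]
  have hL := fun t => (local_collapse (A.keyQ e) t)
  have hU := fun t => local_sandwich_lift (A.code e) (describedUnitary (m := P.n + 1) t)
  change ∑ t, sandwich (lift (A.code e) (describedUnitary t)) (collapse (A.keyQ e) t
    ((Fintype.card (CliffordKey (P.n + 1)) : ℂ)⁻¹ • ∑ E : CliffordKey (P.n + 1),
      setReg (A.keyQ e) E.bits ρ)) = _
  have h : ∀ t, sandwich (lift (A.code e) (describedUnitary t)) (collapse (A.keyQ e) t
      ((Fintype.card (CliffordKey (P.n + 1)) : ℂ)⁻¹ • ∑ E : CliffordKey (P.n + 1),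
        setReg (A.keyQ e) E.bits ρ)) =
      (Fintype.card (CliffordKey (P.n + 1)) : ℂ)⁻¹ • ∑ E : CliffordKey (P.n + 1),
        if t = E.bits then sandwich (lift (A.code e) E.unitary) (setReg (A.keyQ e) E.bits ρ)
        else 0 := fun t => by
    rw [(hL t).map_smul, (hU t).map_smul, (hL t).map_sum, (hU t).map_sum]
    congr 1
    refine Finset.sum_congr rfl fun E _ => ?_
    rw [collapse_setReg (A.keyQ_injective e)]
    split_ifs with ht
    · rw [ht, describedUnitary_bits]
    · exact (hU t).map_zero
  rw [Finset.sum_congr rfl fun t _ => h t, ← Finset.smul_sum, Finset.sum_comm]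
  simp

end Trace

end Adversary

theorem Local.trace_mul_smul_sum {G : Type} [Fintype G] [DecidableEq G] {s : Set G}
    {Φ : Op G → Op G} (h : Local s Φ) (M : Op G) (c : ℂ) {ι : Type} (t : Finset ι)
    (ρ : ι → Op G) :
    (M * Φ (c • ∑ i ∈ t, ρ i)).trace = c * ∑ i ∈ t, (M * Φ (ρ i)).trace := by
  rw [h.map_smul, h.map_sum, Matrix.mul_smul, Matrix.trace_smul, smul_eq_mul, Finset.mul_sum,
    Matrix.trace_sum]

theorem Local.univ {G : Type} [Fintype G] [DecidableEq G] {s : Set G} {Φ : Op G → Op G}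
    (h : Local s Φ) : Local Set.univ Φ :=
  h.mono (Set.subset_univ s)

namespace Adversary
variable {P : Task} {r : ℕ} (A : Adversary P r) (e : ℕ)

theorem decode_of_mem (hi : P.i ∈ P.corrupt) (E : CliffordKey (P.n + 1)) (ρ : Op (A.Global e)) :
    A.decode e E ρ = ρ := by
  rw [decode, if_pos hi]

theorem disjoint_code_keyQ : Disjoint (Set.range (A.code e)) (Set.range (A.keyQ e)) :=
  disjoint_range fun x y h => by cases x using Fin.cases <;> simp [code] at h

theorem trace_decodingProtocol_some (M : Op (A.Global e)) (E : CliffordKey (P.n + 1))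
    (o : {v : Fin P.W // v ≠ P.w} → Bool) (ρ : Op (A.Global e)) :
    (M * A.decodingProtocol e (some (E, o)) ρ).trace =
      ∑ m : P.Bad → Bool, (M * if m = fun _ => false
        then A.decode e E (collapse (A.mpcQ e) m
          (A.keyRun e (if P.i ∈ P.corrupt then setReg (A.keyQ e) E.bits ρ else ρ)))
        else A.abort e (collapse (A.mpcQ e) m
          (A.keyRun e (if P.i ∈ P.corrupt then setReg (A.keyQ e) E.bits ρ else ρ)))).trace := by
  rw [← Matrix.trace_sum, ← Finset.mul_sum]
  rfl

/-- Neither the encoding unitary nor the adversary's second program touches the key register, so the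
simulator's early write can be moved after both. What remains is the real state with the key
delivered later. -/
theorem run_encodeProg_encodedRun (hi : P.i ∈ P.corrupt) (ρ : Op (A.Global e)) :
    A.encodedRun e (A.encodeProg.run (A.lateQ e) (A.circuitRun e ρ)) =
      (Fintype.card (CliffordKey (P.n + 1)) : ℂ)⁻¹ • ∑ E : CliffordKey (P.n + 1),
        setReg (A.keyQ e) E.bits (A.afterEncoding e E ρ) := by
  have d : Disjoint (Set.range (A.keyQ e)) _ := A.disjoint_held₁ e (fun x => .key x) fun _ => id
  rw [A.run_encodeProg_of_mem e hi, (A.local_encodedRun e).map_smul, (A.local_encodedRun e).map_sum]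
  congr 1
  refine Finset.sum_congr rfl fun E _ => ?_
  rw [Local.commute (A.disjoint_code_keyQ e) (local_sandwich_lift _ _) (local_setReg _ _),
    ← Local.commute d (local_setReg _ _) (A.local_encodedRun e)]
  rfl

theorem collapse_keyQ_afterEncoding {ρ : Op (A.Global e)}
    (hρ : collapse (A.keyQ e) (fun _ => false) ρ = ρ) (E : CliffordKey (P.n + 1)) :
    collapse (A.keyQ e) (fun _ => false) (A.afterEncoding e E ρ) = A.afterEncoding e E ρ := by
  have d : Disjoint (Set.range (A.keyQ e)) _ := A.disjoint_held₁ e (fun x => .key x) fun _ => id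
  have h : A.afterEncoding e E ρ =
      A.encodedRun e (sandwich (lift (A.code e) E.unitary) (A.circuitRun e ρ)) := rfl
  rw [h, Local.commute d (local_collapse _ _) (A.local_encodedRun e),
    ← Local.commute (A.disjoint_code_keyQ e) (local_sandwich_lift _ _) (local_collapse _ _),
    A.collapse_circuitRun e (fun x => .key x) (fun _ => id) (by simp), hρ]

section Trace
variable {M : Op (A.Global e)} (hM : ActsOn (Set.range (A.outputQ e)) M)
include hM

theorem trace_real_of_mem (hi : P.i ∈ P.corrupt) {ρ : Op (A.Global e)}
    (hρ : collapse (A.keyQ e) (fun _ => false) ρ = ρ) :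
    (M * ∑ s, A.decodingProtocol e s (A.idealWithoutDecoding e ρ s)).trace =
      (M * A.simulatedRun e ρ).trace := by
  have dkey : Disjoint (Set.range (A.bitQ e)) (Set.range (A.keyQ e)) :=
    disjoint_range fun x y h => by cases h
  have hbit := fun b => (local_collapse (A.bitQ e) b).univ
  -- From here to `hs` only linearity matters, to pull the average over keys out of each term; the
  -- supports are therefore relaxed to all qubits.
  have hK : ∀ m, Local Set.univ fun σ => collapse (A.mpcQ e) m
      (A.keyRun e (collapse (A.bitQ e) (fun _ => false) σ)) := fun m =>
    .comp (local_collapse _ m).univ (.comp (A.local_keyRun e).univ (hbit _))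
  have hm : ∀ m : P.Bad → Bool, Local Set.univ fun σ => if m = fun _ => false
      then collapse (A.mpcQ e) m (A.keyRun e (collapse (A.bitQ e) (fun _ => false) σ))
      else A.abort e (collapse (A.mpcQ e) m
        (A.keyRun e (collapse (A.bitQ e) (fun _ => false) σ))) := fun m =>
    .ite _ (hK m) (.comp (A.local_abort e).univ (hK m))
  have hs : ∀ s : P.Bad → Bool, Local Set.univ fun σ =>
      A.abort e (A.keyRun e (A.setStatus e (A.forgetRun e (collapse (A.bitQ e) s σ)))) := fun s =>
    .comp (A.local_abort e).univ (.comp (A.local_keyRun e).univ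
      (.comp (local_setReg _ _).univ (.comp (A.local_forgetRun e).univ (hbit s))))
  rw [simulatedRun, A.trace_abortUnlessZero_outputProg e hM (A.run_encodeProg_encodedRun e hi ρ),
    Finset.sum_congr rfl fun m _ => (hm m).trace_mul_smul_sum M _ _ _,
    Finset.sum_congr rfl fun s _ => (hs s).trace_mul_smul_sum M _ _ _,
    ← Finset.mul_sum, ← Finset.mul_sum, ← mul_add, Finset.sum_comm,
    Finset.sum_comm (s := Finset.univ.erase _), ← Finset.sum_add_distrib, A.trace_real e hM]
  refine congrArg _ (Finset.sum_congr rfl fun E _ => congrArg₂ _ ?_ ?_)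
  · rw [trace_decodingProtocol_some]
    refine Finset.sum_congr rfl fun m _ => ?_
    rw [if_pos hi, A.decode_of_mem e hi,
      Local.commute dkey (local_collapse _ _) (local_setReg _ _)]
  -- Rejecting terms: forgetting turns the written key into zeros, which is what the real key
  -- register has contained from the start.
  · refine Finset.sum_congr rfl fun s _ => ?_
    rw [Local.commute dkey (local_collapse _ _) (local_setReg _ _), A.forgetRun_setReg e hi,
      ← Local.commute dkey (local_collapse _ _) (local_setReg _ _),
      setReg_eq_self (A.keyQ_injective e) _ (A.collapse_keyQ_afterEncoding e hρ E)]

/-! ### Player `i` is honest -/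

omit hM in
theorem lift_code_unitary (E : CliffordKey (P.n + 1)) :
    (lift (A.code e) E.unitary)ᴴ * lift (A.code e) E.unitary = 1 := by
  rw [lift_conjTranspose, lift_mul (A.code_injective e), ← Matrix.star_eq_conjTranspose,
    Matrix.mem_unitaryGroup_iff'.1 E.unitary_mem, lift_one]

omit hM in
-- The code was not touched, so decoding cancels the encoding and the traps can only read zero.
theorem decode_sandwich_unitary (hi : P.i ∉ P.corrupt) (E : CliffordKey (P.n + 1))
    {ρ : Op (A.Global e)} (hρ : collapse (A.trapQ e) (fun _ => false) ρ = ρ) :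
    A.decode e E (sandwich (lift (A.code e) E.unitary) ρ) = ρ := by
  rw [decode, if_neg hi, sandwich_sandwich, ← lift_conjTranspose, lift_code_unitary, sandwich_one]
  change (∑ t, if t = fun _ => false then collapse (A.trapQ e) t ρ
    else A.abort e (collapse (A.trapQ e) t ρ)) = ρ
  rw [Finset.sum_eq_single (fun _ => false)]
  · rw [if_pos rfl, hρ]
  · intro t _ ht
    rw [if_neg ht, ← hρ, collapse_collapse, if_neg ht, (A.local_abort e).map_zero]
  · exact fun h => absurd (Finset.mem_univ _) h

/-- The encoding acts on the output wire, which the abort erases, and on the traps, which the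
environment does not receive. -/
theorem trace_abort_sandwich_unitary (hi : P.i ∉ P.corrupt) (E : CliffordKey (P.n + 1))
    (ρ : Op (A.Global e)) :
    (M * A.abort e (sandwich (lift (A.code e) E.unitary) ρ)).trace =
      (M * A.abort e ρ).trace := by
  have d : Disjoint (Set.range fun j : P.Good => (Sum.inl (.flag j) : A.Global e))
      (Set.range (A.code e)) :=
    disjoint_range fun x y h => by cases y using Fin.cases <;> simp [code] at h
  simp only [abort, if_neg hi]
  rw [Local.commute d (local_setReg _ _) (local_sandwich_lift _ _)]
  refine trace_mul_setReg_sandwich hM (fun _ _ _ => rfl) ?_ (actsOn_lift (A.code e) _)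
    (A.lift_code_unitary e E) _ _
  rw [Set.disjoint_right]
  rintro _ ⟨x, rfl⟩ ⟨⟨y, hy⟩, hw⟩
  cases x using Fin.cases with
  | zero => exact hw ⟨(), rfl⟩
  | succ t => rcases y with y | y | y | y <;> simp [code, outputQ] at hy

omit hM in
theorem disjoint_code_held₁ (hi : P.i ∉ P.corrupt) : Disjoint (Set.range (A.code e))
    (Set.range fun x : {x : RealReg P r A.work // x.Held₁} => (Sum.inl x.1 : A.Global e)) := by
  refine A.disjoint_held₁ e (fun x => Fin.cases (.wire P.w) (fun t => .trap t) x) fun x => ?_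
  cases x using Fin.cases with
  | zero => exact fun h => hi h.2
  | succ t => exact hi

omit hM in
theorem disjoint_code_held₂ (hi : P.i ∉ P.corrupt) : Disjoint (Set.range (A.code e))
    (Set.range fun x : {x : RealReg P r A.work // x.Held₂} => (Sum.inl x.1 : A.Global e)) := by
  refine A.disjoint_held₂ e (fun x => Fin.cases (.wire P.w) (fun t => .trap t) x) fun x => ?_
  cases x using Fin.cases with
  | zero => exact fun h => hi h.2
  | succ t => exact hi

theorem trace_real_of_notMem (hi : P.i ∉ P.corrupt) {ρ : Op (A.Global e)}
    (hρ : collapse (A.trapQ e) (fun _ => false) ρ = ρ) :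
    (M * ∑ s, A.decodingProtocol e s (A.idealWithoutDecoding e ρ s)).trace =
      (M * A.simulatedRun e ρ).trace := by
  -- The state in which the encoding has been left out altogether; this is also the simulator's
  -- state, as `encodeProg` is trivial for honest `i`.
  set σ := A.encodedRun e (A.circuitRun e ρ) with hσ
  have henc : A.encodedRun e (A.encodeProg.run (A.lateQ e) (A.circuitRun e ρ)) = σ := by
    rw [encodeProg, dif_neg hi]
    rfl
  have hforget : ∀ X, A.forgetRun e X = X := fun X => by
    rw [forgetRun, forgetProg, dif_neg hi]
    rfl
  have d {L : Type} (f : L → RealReg P r A.work) (h1 : ∀ x, f x ≠ .wire P.w)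
      (h2 : ∀ x t, f x ≠ .trap t) :
      Disjoint (Set.range (A.code e)) (Set.range fun x => (Sum.inl (f x) : A.Global e)) :=
    disjoint_range fun x y h => by
      cases x using Fin.cases with
      | zero => exact h1 y (Sum.inl_injective h).symm
      | succ t => exact h2 y t (Sum.inl_injective h).symm
  have dtrap₁ : Disjoint (Set.range (A.trapQ e)) _ :=
    A.disjoint_held₁ e (fun x => .trap x) fun _ => hi
  have dtrap₂ : Disjoint (Set.range (A.trapQ e)) _ :=
    A.disjoint_held₂ e (fun x => .trap x) fun _ => hi
  have htrap : collapse (A.trapQ e) (fun _ => false) σ = σ := by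
    rw [hσ, Local.commute dtrap₁ (local_collapse _ _) (A.local_encodedRun e),
      A.collapse_circuitRun e (fun x => .trap x) (fun _ => id) (by simp), hρ]
  have hU := fun E : CliffordKey (P.n + 1) => local_sandwich_lift (A.code e) E.unitary
  have hbit : ∀ (E : CliffordKey (P.n + 1)) b X,
      collapse (A.bitQ e) b (sandwich (lift (A.code e) E.unitary) X) =
        sandwich (lift (A.code e) E.unitary) (collapse (A.bitQ e) b X) := fun E b X =>
    (Local.commute (d _ (by simp) (by simp)) (hU E) (local_collapse _ _) X).symm
  have hmpc : ∀ (E : CliffordKey (P.n + 1)) b X,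
      collapse (A.mpcQ e) b (sandwich (lift (A.code e) E.unitary) X) =
        sandwich (lift (A.code e) E.unitary) (collapse (A.mpcQ e) b X) := fun E b X =>
    (Local.commute (d _ (by simp) (by simp)) (hU E) (local_collapse _ _) X).symm
  have hstat : ∀ (E : CliffordKey (P.n + 1)) X,
      A.setStatus e (sandwich (lift (A.code e) E.unitary) X) =
        sandwich (lift (A.code e) E.unitary) (A.setStatus e X) := fun E X =>
    (Local.commute (d _ (by simp) (by simp)) (hU E) (local_setReg _ _) X).symm
  have hkey : ∀ (E : CliffordKey (P.n + 1)) X,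
      A.keyRun e (sandwich (lift (A.code e) E.unitary) X) =
        sandwich (lift (A.code e) E.unitary) (A.keyRun e X) := fun E X =>
    (Local.commute (A.disjoint_code_held₂ e hi) (hU E) (A.local_keyRun e) X).symm
  have hafter : ∀ E : CliffordKey (P.n + 1),
      A.afterEncoding e E ρ = sandwich (lift (A.code e) E.unitary) σ := fun E =>
    (Local.commute (A.disjoint_code_held₁ e hi) (hU E) (A.local_encodedRun e) _).symm
  rw [simulatedRun, A.trace_abortUnlessZero_outputProg e hM henc, A.trace_real e hM]
  -- For every key the summand equals the simulated value, so averaging over keys changes nothing.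
  refine Eq.trans (congrArg _ (Finset.sum_congr rfl fun E _ => ?_))
    (CliffordKey.smul_sum_const (m := P.n + 1) _)
  rw [hafter]
  refine congrArg₂ _ ?_ ?_
  · rw [trace_decodingProtocol_some]
    refine Finset.sum_congr rfl fun m _ => ?_
    rw [if_neg hi, hbit, hkey, hmpc]
    split_ifs with hm
    -- It remains to see that the traps are still zero: the bit measurements and the last program
    -- act on other qubits.
    · rw [decode_sandwich_unitary A e hi E]
      rw [Local.commute (disjoint_range fun x y h => by cases h) (local_collapse (A.trapQ e) _)
          (local_collapse (A.mpcQ e) _),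
        Local.commute dtrap₂ (local_collapse _ _) (A.local_keyRun e),
        Local.commute (disjoint_range fun x y h => by cases h) (local_collapse (A.trapQ e) _)
          (local_collapse (A.bitQ e) _), htrap]
    · exact A.trace_abort_sandwich_unitary e hM hi E _
  · refine Finset.sum_congr rfl fun s _ => ?_
    rw [hforget, hbit, hstat, hkey, A.trace_abort_sandwich_unitary e hM hi]

end Trace

/-! ### The ideal experiment -/

/-- The qubit of the real world represented by a qubit of the ideal world. -/
def globalToReal : A.simulator.Global e → A.Global e := Sum.map A.toReal id

theorem globalToReal_injective : Function.Injective (A.globalToReal e) :=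
  A.toReal_injective.sumMap Function.injective_id

/-- Each stage intertwines with the isometry, and the simulator's renamed programs act on the
represented real qubits by `toReal_embed₀` and `toReal_embed₁`. -/
theorem prepare_idealMPQC (ρ : Op (A.simulator.Global e)) :
    prepare (A.globalToReal e) (A.simulator.idealMPQC e ρ) =
      A.simulatedRun e (prepare (A.globalToReal e) ρ) := by
  have hf := A.globalToReal_injective e
  have habort : ∀ X, prepare (A.globalToReal e) (A.simulator.abort e X) =
      A.abort e (prepare (A.globalToReal e) X) := fun X => by
    have h1 := setReg_comp_prepare hf
      (fun j : P.Good => (Sum.inl (.flag j) : A.simulator.Global e)) (fun _ => true) X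
    have h2 := fun Y => setReg_comp_prepare hf
      (fun _ : Unit => (Sum.inl (.wire P.w) : A.simulator.Global e)) (fun _ => false) Y
    by_cases hi : P.i ∈ P.corrupt
    · simp only [Simulator.abort, Adversary.abort, if_pos hi]
      exact h1.symm
    · simp only [Simulator.abort, Adversary.abort, if_neg hi]
      rw [← h2, ← h1]
      rfl
  have hin : ∀ X, prepare (A.globalToReal e)
      (A.simulator.onInput.run (fun x => Sum.inl x.1) X) =
      A.onInput.run (fun x => Sum.inl x.1) (prepare (A.globalToReal e) X) := fun X => by
    rw [← prog_run_prepare hf]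
    refine (Prog.run_map _ _ _ _).trans ?_
    congr 1
    exact funext fun x => congrArg Sum.inl (A.toReal_embed₀ x)
  have hout : ∀ X, prepare (A.globalToReal e)
      (A.simulator.onOutput.run (fun x => Sum.inl x.1) X) =
      A.outputProg.run (A.lateQ e) (prepare (A.globalToReal e) X) := fun X => by
    rw [← prog_run_prepare hf]
    refine (Prog.run_map _ _ _ _).trans ?_
    congr 1
    exact funext fun x => congrArg Sum.inl (A.toReal_embed₁ x)
  have hcirc : ∀ X, prepare (A.globalToReal e)
      (runCircuit (fun v => (Sum.inl (.wire v) : A.simulator.Global e)) P.C X) =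
      runCircuit (fun v => (Sum.inl (.wire v) : A.Global e)) P.C
        (prepare (A.globalToReal e) X) := fun X =>
    (runCircuit_prepare hf _ _ _).symm
  have hbit : ∀ b X, prepare (A.globalToReal e)
      (collapse (fun j : P.Bad => (Sum.inl (.bit j) : A.simulator.Global e)) b X) =
      collapse (A.bitQ e) b (prepare (A.globalToReal e) X) := fun b X =>
    (collapse_comp_prepare hf _ _ _).symm
  rw [Simulator.idealMPQC, prepare_sum hf, simulatedRun, abortUnlessZero]
  refine Finset.sum_congr rfl fun b _ => ?_
  rw [circuitRun, ← hin, ← hcirc, ← hout, ← hbit, ← habort, apply_ite (prepare _)]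

theorem realProb_eq_idealProb (Z : Environment P r) :
    realProb A Z = idealProb A.simulator Z := by
  have hf := A.globalToReal_injective Z.e
  let inputs : P.InputWire ⊕ Fin r ⊕ Fin Z.e → A.simulator.Global Z.e
    | .inl v => .inl (.wire v.1)
    | .inr (.inl x) => .inl (.side x)
    | .inr (.inr x) => .inr x
  let outputs : Unit ⊕ P.Good ⊕ Fin r ⊕ Fin Z.e → A.simulator.Global Z.e
    | .inl _ => .inl (.wire P.w)
    | .inr (.inl j) => .inl (.flag j)
    | .inr (.inr (.inl x)) => .inl (.side x)
    | .inr (.inr (.inr x)) => .inr x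
  have hI : idealProb A.simulator Z =
      (lift outputs Z.M * A.simulator.idealMPQC Z.e (prepare inputs Z.ρ)).trace.re := by
    unfold idealProb
    rfl
  let inputs' : P.InputWire ⊕ Fin r ⊕ Fin Z.e → A.Global Z.e
    | .inl v => .inl (.wire v.1)
    | .inr (.inl x) => .inl (.side x)
    | .inr (.inr x) => .inr x
  let outputs' : Unit ⊕ P.Good ⊕ Fin r ⊕ Fin Z.e → A.Global Z.e
    | .inl _ => .inl (.wire P.w)
    | .inr (.inl j) => .inl (.flag j)
    | .inr (.inr (.inl x)) => .inl (.side x)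
    | .inr (.inr (.inr x)) => .inr x
  have hR : realProb A Z = (lift outputs' Z.M * ∑ s, A.decodingProtocol Z.e s
      (A.idealWithoutDecoding Z.e (prepare inputs' Z.ρ) s)).trace.re := by
    unfold realProb
    rfl
  have hin' : inputs' = A.inputQ Z.e := by
    funext x
    rcases x with x | x | x <;> rfl
  have hout' : outputs' = A.outputQ Z.e := by
    funext x
    rcases x with x | x | x | x <;> rfl
  have hin : (fun x => A.globalToReal Z.e (inputs x)) = A.inputQ Z.e := by
    funext x
    rcases x with x | x | x <;> rfl
  have hout : (fun x => A.globalToReal Z.e (outputs x)) = A.outputQ Z.e := by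
    funext x
    rcases x with x | x | x | x <;> rfl
  rw [hI, hR, hin', hout', ← trace_lift_mul_prepare hf, prepare_idealMPQC, prepare_prepare hf, hin,
    hout]
  refine congrArg _ ?_
  -- The environment prepares only input wires, side information and private qubits, so the keys and
  -- traps start in state zero, as each case requires.
  by_cases hi : P.i ∈ P.corrupt
  · exact A.trace_real_of_mem Z.e (actsOn_lift _ _) hi
      (A.collapse_prepare_inputQ Z.e (fun x => .key x) (by simp) (by simp) _)
  · exact A.trace_real_of_notMem Z.e (actsOn_lift _ _) hi
      (A.collapse_prepare_inputQ Z.e (fun x => .trap x) (by simp) (by simp) _)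

end Adversary

end MPQC

end

theorem mainTheorem12 :
    ∃ p : Polynomial ℕ,
      ∀ (P : MPQC.Task), MPQC.LeavesOnly P.w ∅ P.C → P.corrupt ⊂ Finset.univ →
        ∀ (r : ℕ) (A : MPQC.Adversary P r), ∃ S : MPQC.Simulator P r,
          S.complexity ≤ p.eval A.complexity ∧
            ∀ Z : MPQC.Environment P r, MPQC.realProb A Z = MPQC.idealProb S Z := by
  refine ⟨2 * (Polynomial.X + 1) ^ 3 + 6 * Polynomial.X + 4, fun P _ _ r A => ⟨A.simulator, ?_,
    A.realProb_eq_idealProb⟩⟩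
  simpa using A.complexity_simulator_le
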